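/- Let $\mathcal E$ and $\mathcal E_*$ be finite-dimensional complex Hilbert spaces, let $\mathbb T$ be the unit circle with normalized Lebesgue measure, and let $H^2_{\mathcal E}\subset L^2_{\mathcal E}$ be the Hardy space, i.e. the closed subspace of those $f\in L^2_{\mathcal E}(\mathbb T)$ whose Fourier coefficients of negative index vanish. Let $H^\infty_{\mathcal B(\mathcal E,\mathcal E_*)}$ be the space of bounded analytic $\mathcal B(\mathcal E,\mathcal E_*)$-valued functions on the open unit disc $\mathbb D$, regarded as a subspace of $L^\infty_{\mathcal B(\mathcal E,\mathcal E_*)}(\mathbb T)$ through radial boundary values, and let $\bar H^\infty_{\mathcal B(\mathcal E,\mathcal E_*)}=\{\Psi(\bar z):\Psi\in H^\infty_{\mathcal B(\mathcal E,\mathcal E_*)}\}$. Let $\Phi\in H^\infty_{\mathcal B(\mathcal E,\mathcal E_*)}+\bar H^\infty_{\mathcal B(\mathcal E,\mathcal E_*)}$ be a nonzero element of $L^\infty_{\mathcal B(\mathcal E,\mathcal E_*)}$ such that $\Phi(e^{it})$ is a partial isometry for almost every $e^{it}\in\mathbb T$. Denote by $\hat\Phi(n)\in\mathcal B(\mathcal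 E,\mathcal E_*)$, $n\in\mathbb Z$, its Fourier coefficients, put $$\Phi_+(z)=\sum_{m=0}^\infty\hat\Phi(m)z^m,\qquad \Phi_-(z)=\sum_{m=0}^\infty\hat\Phi(-m)\bar z^m\qquad(z\in\mathbb D),$$ and write $\Phi_\pm(e^{it})$ for the radial boundary values. Let $T_\Phi:H^2_{\mathcal E}\to H^2_{\mathcal E_*}$, $T_\Phi h=P_+(\Phi h)$, be the Toeplitz operator with symbol $\Phi$, where $P_+$ is the orthogonal projection of $L^2_{\mathcal E_*}$ onto $H^2_{\mathcal E_*}$. (A bounded operator $T$ is a partial isometry if $\|Th\|=\|h\|$ for all $h\in(\ker T)^\perp$.) Then $T_\Phi$ is a partial isometry if and only if the following two conditions hold: 1. $\Phi_+$ and $\Phi_-^*$ are contractive analytic functions on $\mathbb D$ (with values in $\mathcal B(\mathcal E,\mathcal E_*)$ and $\mathcal B(\mathcal E_*,\mathcal E)$ respectively), and $\Phi_+(e^{it})^*\Phi_+(e^{it})$ and $\Phi_-(e^{it})\Phi_-(e^{it})^*$ are constant operator-valued functions a.e. on $\mathbb T$; 2. $\hat\Phi(m)^*\hat\Phi(-n)=0$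 and $\hat\Phi(-n)\hat\Phi(m)^*=0$ for all $m,n\ge 1$. -/

import Mathlib

open MeasureTheory Filter Topology AddCircle
open scoped ENNReal ComplexConjugate

noncomputable section

namespace ToeplitzPI

/-- The unit circle `𝕋`, parametrised by `t ↦ exp (2 π i t)`, `t ∈ ℝ / ℤ`; it always carries the
normalized Lebesgue measure `haarAddCircle`. -/
abbrev Torus : Type := AddCircle (1 : ℝ)

/-- The point `exp (2 π i t)` of the unit circle, as a complex number. -/
def circlePt (t : Torus) : ℂ := (toCircle t : ℂ)

/-- `L²_E`. -/
abbrev L2 (E : Type*) [NormedAddCommGroup E] : Type _ :=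
  Lp E 2 (haarAddCircle : Measure Torus)

/-- `L^∞_{B(E,F)}`. -/
abbrev LInf (E F : Type*) [NormedAddCommGroup E] [NormedSpace ℂ E]
    [NormedAddCommGroup F] [NormedSpace ℂ F] : Type _ :=
  Lp (E →L[ℂ] F) ∞ (haarAddCircle : Measure Torus)

section General

variable {E F : Type*} [NormedAddCommGroup E] [InnerProductSpace ℂ E] [CompleteSpace E]
  [NormedAddCommGroup F] [InnerProductSpace ℂ F] [CompleteSpace F]

/-- A bounded operator is a partial isometry if it is isometric on the orthogonal complement of
its kernel. -/
def IsPartialIsometry (T : E →L[ℂ] F) : Prop :=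
  ∀ h ∈ (LinearMap.ker (T : E →ₗ[ℂ] F))ᗮ, ‖T h‖ = ‖h‖

/-- The `n`-th Fourier coefficient as a bounded linear map on `L²_E`. -/
def coeffL2 (E : Type*) [NormedAddCommGroup E] [InnerProductSpace ℂ E] [CompleteSpace E]
    (n : ℤ) : L2 E →L[ℂ] E :=
  (ContinuousLinearMap.lsmul ℂ ℂ).lpPairing haarAddCircle 2 2 (fourierLp 2 (-n))

theorem coeffL2_apply (n : ℤ) (f : L2 E) : coeffL2 E n f = fourierCoeff (f : Torus → E) n := by
  rw [coeffL2, ContinuousLinearMap.lpPairing_eq_integral, fourierCoeff]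
  apply integral_congr_ae
  filter_upwards [coeFn_fourierLp (T := (1 : ℝ)) 2 (-n)] with t ht
  rw [ht]
  rfl

/-- The Hardy space `H²_E`, as the closed subspace of `L²_E` of all functions whose Fourier
coefficients of negative index vanish. -/
def H2 (E : Type*) [NormedAddCommGroup E] [InnerProductSpace ℂ E] [CompleteSpace E] :
    Submodule ℂ (L2 E) where
  carrier := {f | ∀ n : ℤ, n < 0 → fourierCoeff (f : Torus → E) n = 0}
  add_mem' := by
    intro f g hf hg n hn
    have hf' := hf n hn
    have hg' := hg n hn
    rw [← coeffL2_apply] at hf' hg' ⊢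
    rw [map_add, hf', hg', add_zero]
  zero_mem' := by
    intro n _
    rw [← coeffL2_apply, map_zero]
  smul_mem' := by
    intro c f hf n hn
    have hf' := hf n hn
    rw [← coeffL2_apply] at hf' ⊢
    rw [map_smul, hf', smul_zero]

theorem mem_H2 {f : L2 E} :
    f ∈ H2 E ↔ ∀ n : ℤ, n < 0 → fourierCoeff (f : Torus → E) n = 0 := Iff.rfl

theorem isClosed_H2 : IsClosed (H2 E : Set (L2 E)) := by
  have h : (H2 E : Set (L2 E)) = ⋂ (n : ℤ) (_ : n < 0), {f | coeffL2 E n f = 0} := by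
    ext f
    simp [mem_H2, coeffL2_apply]
  rw [h]
  exact isClosed_iInter fun n => isClosed_iInter fun _ =>
    isClosed_eq (coeffL2 E n).continuous continuous_const

instance instCompleteH2 : CompleteSpace (H2 E) := isClosed_H2.completeSpace_coe

/-- The Laurent operator `L_Φ : L²_E → L²_F`, `h ↦ Φ h`. -/
def laurent (Φ : LInf E F) : L2 E →L[ℂ] L2 F :=
  (ContinuousLinearMap.id ℂ (E →L[ℂ] F)).holderL haarAddCircle ∞ 2 2 Φ

set_option linter.unusedSectionVars false in
theorem laurent_coeFn (Φ : LInf E F) (h : L2 E) :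
    (laurent Φ h : Torus → F) =ᵐ[haarAddCircle]
      fun t => (Φ : Torus → E →L[ℂ] F) t ((h : Torus → E) t) :=
  ContinuousLinearMap.coeFn_holder _ Φ h

/-- The Toeplitz operator `T_Φ : H²_E → H²_F`, `h ↦ P₊ (Φ h)`. -/
def toeplitz (Φ : LInf E F) : H2 E →L[ℂ] H2 F :=
  (H2 F).orthogonalProjectionOnto ∘L laurent Φ ∘L (H2 E).subtypeL

/-- `f` is the boundary function on `𝕋` of the function `Θ` on the unit disc: for almost every
point `ζ` of the circle, `Θ (r ζ)` tends to the value of `f` at `ζ` as `r ↑ 1`. -/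
def HasBoundaryValues (Θ : ℂ → E →L[ℂ] F) (f : Torus → E →L[ℂ] F) : Prop :=
  ∀ᵐ t ∂(haarAddCircle : Measure Torus),
    Tendsto (fun r : ℝ => Θ ((r : ℂ) * circlePt t)) (𝓝[<] 1) (𝓝 (f t))

/-- `Θ` is a bounded analytic function on the open unit disc. -/
def IsBoundedAnalytic (Θ : ℂ → E →L[ℂ] F) : Prop :=
  DifferentiableOn ℂ Θ (Metric.ball 0 1) ∧ ∃ C : ℝ, ∀ z ∈ Metric.ball (0 : ℂ) 1, ‖Θ z‖ ≤ C

/-- `Θ` is a contractive analytic function on the open unit disc. -/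
def IsContractiveAnalytic (Θ : ℂ → E →L[ℂ] F) : Prop :=
  DifferentiableOn ℂ Θ (Metric.ball 0 1) ∧
    ∀ z ∈ Metric.ball (0 : ℂ) 1, ∀ a : E, ‖Θ z a‖ ≤ ‖a‖

/-- `H^∞_{B(E,F)}`, identified with a subset of `L^∞_{B(E,F)}` through boundary values. -/
def HInf (E F : Type*) [NormedAddCommGroup E] [InnerProductSpace ℂ E] [CompleteSpace E]
    [NormedAddCommGroup F] [InnerProductSpace ℂ F] [CompleteSpace F] : Set (LInf E F) :=
  {f | ∃ Θ : ℂ → E →L[ℂ] F, IsBoundedAnalytic Θ ∧ HasBoundaryValues Θ f}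

/-- The functions `Ψ (conj z)` with `Ψ` in `H^∞_{B(E,F)}`, as a subset of `L^∞_{B(E,F)}`. -/
def HInfBar (E F : Type*) [NormedAddCommGroup E] [InnerProductSpace ℂ E] [CompleteSpace E]
    [NormedAddCommGroup F] [InnerProductSpace ℂ F] [CompleteSpace F] : Set (LInf E F) :=
  {f | ∃ Ψ : ℂ → E →L[ℂ] F, IsBoundedAnalytic Ψ ∧ HasBoundaryValues (fun z => Ψ (conj z)) f}

/-- The class of sums of an element of `H^∞` and an element of its conjugate. -/
def HInfAddHInfBar (E F : Type*) [NormedAddCommGroup E] [InnerProductSpace ℂ E] [CompleteSpace E]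
    [NormedAddCommGroup F] [InnerProductSpace ℂ F] [CompleteSpace F] : Set (LInf E F) :=
  {Φ | ∃ f ∈ HInf E F, ∃ g ∈ HInfBar E F, Φ = f + g}

/-- The Fourier coefficient `Φ̂(n)`. -/
def symbolCoeff (Φ : LInf E F) (n : ℤ) : E →L[ℂ] F :=
  fourierCoeff (Φ : Torus → E →L[ℂ] F) n

/-- The analytic part `Φ₊(z) = ∑_{m ≥ 0} Φ̂(m) z^m`, for `|z| < 1`. -/
def analyticPart (Φ : LInf E F) (z : ℂ) : E →L[ℂ] F :=
  ∑' m : ℕ, z ^ m • symbolCoeff Φ (m : ℤ)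

/-- The co-analytic part `Φ₋(z) = ∑_{m ≥ 0} Φ̂(-m) (conj z)^m`, for `|z| < 1`. -/
def coanalyticPart (Φ : LInf E F) (z : ℂ) : E →L[ℂ] F :=
  ∑' m : ℕ, (conj z) ^ m • symbolCoeff Φ (-(m : ℤ))

/-- `g` agrees almost everywhere on `𝕋` with a constant operator. -/
def IsAEConstant (g : Torus → E →L[ℂ] F) : Prop :=
  ∃ A : E →L[ℂ] F, ∀ᵐ t ∂(haarAddCircle : Measure Torus), g t = A

end General

end ToeplitzPI

end

noncomputable section

namespace ToeplitzPI

set_option linter.unusedSectionVars false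

/-! ### Partial isometries satisfying a Toeplitz equation, in abstract Hilbert space. -/

section Hilbert

open ContinuousLinearMap
open scoped InnerProductSpace InnerProduct

variable {H K : Type*} [NormedAddCommGroup H] [InnerProductSpace ℂ H] [CompleteSpace H]
  [NormedAddCommGroup K] [InnerProductSpace ℂ K] [CompleteSpace K]

/-! Write `P`, `M` for the boundary values of the analytic and co-analytic parts and `p₀` for the
mean, so that `Φ = P + M - p₀`.

Necessity. A Toeplitz operator satisfies `S* T S = T` with `S` the shift. If `T` is also a partial
isometry, norm comparison forces its initial space to be shift-invariant and `T` to commute with the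
shifts there (`IsPartialIsometry.toeplitz_intertwine`). Hence `S ^ (m + 1) T h` is orthogonal to `T
c` for every constant `c`. As `T c = P c`, this kills the nonzero Fourier coefficients of `P* P`,
and contractivity on the boundary passes to the disc. Each `Φ̂(-n) e` with `n ≥ 1` is a difference
of the form `T S h - S T h`, so the same orthogonality gives `Φ̂(m)* Φ̂(-n) = 0`. Everything else
follows by applying this to `Φ*`, whose Toeplitz operator is `T*`.

Sufficiency. Let `π` and `ρ` project onto the joint initial and final spaces of the `Φ̂(-n)`, `n ≥
1`. Condition 2 makes `P - p₀` and `M - p₀` live on orthogonal initial and final spaces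
(`splitRelations`), so cross terms cancel and `Φ* Φ = P* P - p₀* p₀ + M* M`. The delicate point is
`Φ̂(m) Φ̂(0)* Φ̂(-n) = 0` (`coeff_comp_mean_comp_coeff`), where the pointwise partial isometry
property and the constancy of `M M*` are combined. Then `Φ f - Φ (T* T f) = B w`, where `B = M M*`
is constant and `w` is the part of `M f` orthogonal to `H²`; projecting to `H²` gives `T T* T f = T
f`. -/

theorem eq_of_norm_le_of_re_inner {x y : H} (hxy : ‖x‖ ≤ ‖y‖)
    (h : RCLike.re ⟪x, y⟫_ℂ = ‖y‖ ^ 2) : x = y := by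
  have h1 := @norm_sub_sq ℂ H _ _ _ x y
  rw [h] at h1
  have h2 : ‖x‖ ^ 2 ≤ ‖y‖ ^ 2 := pow_le_pow_left₀ (norm_nonneg _) hxy 2
  have h3 : ‖x - y‖ = 0 := by
    have := sq_nonneg ‖x - y‖
    exact pow_eq_zero_iff (two_ne_zero) |>.1 (by linarith)
  exact sub_eq_zero.1 (norm_eq_zero.1 h3)

/-- If a contraction preserves the norm of `x`, then `T* T` fixes `x`. -/
theorem adjoint_apply_apply_of_norm_eq {T : H →L[ℂ] K} (hT : ‖T‖ ≤ 1) {x : H}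
    (hx : ‖T x‖ = ‖x‖) : adjoint T (T x) = x := by
  apply eq_of_norm_le_of_re_inner
  · calc ‖adjoint T (T x)‖ ≤ ‖adjoint T‖ * ‖T x‖ := le_opNorm _ _
      _ ≤ 1 * ‖T x‖ := by gcongr; simpa using hT
      _ = ‖x‖ := by rw [one_mul, hx]
  · rw [adjoint_inner_left, inner_self_eq_norm_sq, hx]

theorem IsPartialIsometry.norm_le_one {T : H →L[ℂ] K} (hT : IsPartialIsometry T) : ‖T‖ ≤ 1 := by
  refine T.opNorm_le_bound zero_le_one fun x => ?_
  set N := (LinearMap.ker (T : H →ₗ[ℂ] K)) with hN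
  have hcl : IsClosed (N : Set H) := T.isClosed_ker
  have : CompleteSpace N := hcl.completeSpace_coe
  have hx : T x = T (Nᗮ.starProjection x) := by
    have h1 : x - Nᗮ.starProjection x ∈ N := by
      rw [Submodule.starProjection_orthogonal_val]
      simp
    have h2 : T (x - Nᗮ.starProjection x) = 0 := h1
    rwa [map_sub, sub_eq_zero] at h2
  rw [hx, hT _ (by simp [hN]), one_mul]
  exact Submodule.norm_starProjection_apply_le _ _

/-- Algebraic form `T T* T = T`, the one used throughout. In the converse direction `T* T x - x`,
for `x` orthogonal to the kernel, lies both in the kernel and in its orthogonal complement. -/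
theorem isPartialIsometry_iff {T : H →L[ℂ] K} :
    IsPartialIsometry T ↔ ∀ x, T (adjoint T (T x)) = T x := by
  set N := (LinearMap.ker (T : H →ₗ[ℂ] K)) with hN
  have hcl : IsClosed (N : Set H) := T.isClosed_ker
  have : CompleteSpace N := hcl.completeSpace_coe
  constructor
  · intro hT x
    have hx : T x = T (Nᗮ.starProjection x) := by
      have h1 : x - Nᗮ.starProjection x ∈ N := by
        rw [Submodule.starProjection_orthogonal_val]
        simp
      have h2 : T (x - Nᗮ.starProjection x) = 0 := h1
      rwa [map_sub, sub_eq_zero] at h2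
    rw [hx, adjoint_apply_apply_of_norm_eq hT.norm_le_one (hT _ (by simp [hN]))]
  · intro h x hx
    have h1 : adjoint T (T x) - x = 0 := by
      have hk : adjoint T (T x) - x ∈ N := by
        show T (adjoint T (T x) - x) = 0
        rw [map_sub, h, sub_self]
      have ho : adjoint T (T x) - x ∈ Nᗮ := by
        refine Submodule.sub_mem _ ?_ hx
        intro y hy
        have hy' : T y = 0 := hy
        rw [adjoint_inner_right, hy', inner_zero_left]
      exact inner_self_eq_zero (𝕜 := ℂ) |>.1 (ho _ hk)
    have h2 : ‖T x‖ ^ 2 = ‖x‖ ^ 2 := by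
      rw [← inner_self_eq_norm_sq (𝕜 := ℂ) (T x), ← adjoint_inner_left, sub_eq_zero.1 h1,
        inner_self_eq_norm_sq]
    exact (sq_eq_sq₀ (norm_nonneg _) (norm_nonneg _)).1 h2

theorem isPartialIsometry_adjoint {T : H →L[ℂ] K} (hT : IsPartialIsometry T) :
    IsPartialIsometry (adjoint T) := by
  rw [isPartialIsometry_iff] at hT ⊢
  have h : T ∘L adjoint T ∘L T = T := ContinuousLinearMap.ext hT
  have h2 := congrArg adjoint h
  rw [adjoint_comp, adjoint_comp, adjoint_adjoint] at h2
  intro x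
  rw [adjoint_adjoint]
  exact congrArg (fun A => A x) h2

variable {S : H →L[ℂ] H} {S' : K →L[ℂ] K} {T : H →L[ℂ] K}

/-- The structure of a partial isometry satisfying the Toeplitz equation `S'* T S = T`: its
initial space is invariant under `S`, and `T` intertwines the shifts there. -/
theorem IsPartialIsometry.toeplitz_intertwine (hS : ∀ x, ‖S x‖ = ‖x‖) (hS' : ∀ x, ‖S' x‖ = ‖x‖)
    (hTS : ∀ x, adjoint S' (T (S x)) = T x) (hT : IsPartialIsometry T) (h : H) :
    T (S (adjoint T (T h))) = S' (T h) ∧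
      adjoint T (T (S (adjoint T (T h)))) = S (adjoint T (T h)) := by
  have hT' := isPartialIsometry_iff.1 hT
  set x := adjoint T (T h) with hx
  have hTx : T x = T h := hT' h
  have hadj : ‖adjoint S'‖ ≤ 1 := by
    rw [LinearIsometryEquiv.norm_map]
    exact S'.opNorm_le_bound zero_le_one fun y => by rw [hS', one_mul]
  have hadjle : ∀ y, ‖adjoint S' y‖ ≤ ‖y‖ := fun y =>
    (le_opNorm _ _).trans (by simpa using mul_le_mul_of_nonneg_right hadj (norm_nonneg y))
  have hTle : ∀ y, ‖T y‖ ≤ ‖y‖ := fun y =>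
    (le_opNorm _ _).trans (by
      simpa using mul_le_mul_of_nonneg_right hT.norm_le_one (norm_nonneg y))
  have hxx : ‖T x‖ = ‖x‖ := by
    have : ‖T x‖ ^ 2 = ‖x‖ ^ 2 := by
      rw [← inner_self_eq_norm_sq (𝕜 := ℂ) (T x), ← adjoint_inner_left, hTx, ← hx,
        inner_self_eq_norm_sq]
    exact (sq_eq_sq₀ (norm_nonneg _) (norm_nonneg _)).1 this
  -- The chain `‖x‖ = ‖T x‖ = ‖S'* T S x‖ ≤ ‖T S x‖ ≤ ‖S x‖ = ‖x‖` collapses to equalities; each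
  -- equality case of a contraction `C` gives a relation `C* C y = y`.
  have h1 : ‖x‖ ≤ ‖T (S x)‖ := by
    rw [← hxx, ← hTS x]
    exact hadjle _
  have h2 : ‖T (S x)‖ = ‖S x‖ := le_antisymm (hTle _) (by rw [hS]; exact h1)
  refine ⟨?_, adjoint_apply_apply_of_norm_eq hT.norm_le_one h2⟩
  have h3 : ‖adjoint S' (T (S x))‖ = ‖T (S x)‖ := by
    rw [h2, hS, hTS, hxx]
  have h4 := adjoint_apply_apply_of_norm_eq hadj h3
  rw [adjoint_adjoint, hTS, hTx] at h4
  exact h4.symm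

/-- Iterating the intertwining gives `S' ^ n T = T S ^ n T* T`, with `S ^ n T* T h` still fixed by
`T* T`. The inner product therefore moves back to one of `S (...)` with `c`, a vector orthogonal to
the range of `S`. -/
theorem IsPartialIsometry.toeplitz_inner_eq_zero (hS : ∀ x, ‖S x‖ = ‖x‖)
    (hS' : ∀ x, ‖S' x‖ = ‖x‖)
    (hTS : ∀ x, adjoint S' (T (S x)) = T x) (hT : IsPartialIsometry T)
    {c : H} (hc : ∀ x, ⟪S x, c⟫_ℂ = 0) (h : H) (m : ℕ) :
    ⟪(S' ^ (m + 1)) (T h), T c⟫_ℂ = 0 := by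
  have key : ∀ n : ℕ, T ((S ^ n) (adjoint T (T h))) = (S' ^ n) (T h) ∧
      adjoint T (T ((S ^ n) (adjoint T (T h))))
        = (S ^ n) (adjoint T (T h)) := by
    intro n
    induction n with
    | zero => simp [isPartialIsometry_iff.1 hT h]
    | succ n ih =>
      have h1 := hT.toeplitz_intertwine hS hS' hTS ((S ^ n) (adjoint T (T h)))
      rw [ih.2] at h1
      rw [pow_succ', pow_succ']
      exact ⟨h1.1.trans (congrArg S' ih.1), h1.2⟩
  rw [← (key (m + 1)).1, ← adjoint_inner_left, (key (m + 1)).2, pow_succ']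
  exact hc _

end Hilbert

/-! ### Fourier coefficients of vector-valued functions: calculus and uniqueness. -/

section Fourier

open scoped InnerProductSpace

variable {V W : Type*} [NormedAddCommGroup V] [NormedSpace ℂ V] [CompleteSpace V]
  [NormedAddCommGroup W] [NormedSpace ℂ W] [CompleteSpace W]

theorem fourierCoeff_clm_comp (L : V →L[ℂ] W) {f : Torus → V} (hf : Integrable f haarAddCircle)
    (n : ℤ) : fourierCoeff (fun t => L (f t)) n = L (fourierCoeff f n) := by
  simp only [fourierCoeff, ← map_smul]
  exact L.integral_comp_comm (hf.fourier_smul (-n))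

theorem fourierCoeff_conj_clm_comp (L : V →SL[starRingEnd ℂ] W) {f : Torus → V}
    (hf : Integrable f haarAddCircle) (n : ℤ) :
    fourierCoeff (fun t => L (f t)) n = L (fourierCoeff f (-n)) := by
  -- Viewed as a real-linear map, `L` commutes with the integral; conjugating the exponential then
  -- flips the index.
  let L' : V →L[ℝ] W :=
    { toFun := L
      map_add' := map_add L
      map_smul' := fun r x => by
        have h := L.map_smulₛₗ (r : ℂ) x
        simpa using h
      cont := L.continuous }
  have h := L'.integral_comp_comm (hf.fourier_smul (-(-n)))
  simp only [fourierCoeff]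
  refine Eq.trans (integral_congr_ae (Eventually.of_forall fun t => ?_)) h
  show _ = L _
  rw [map_smulₛₗ, neg_neg, ← fourier_neg]

theorem fourierCoeff_const' (c : V) (n : ℤ) :
    fourierCoeff (fun _ : Torus => c) n = if n = 0 then c else 0 := by
  have h := congrFun (fourierCoeff_fourier (T := 1) 0) n
  simp only [fourierCoeff, fourier_zero, smul_eq_mul, mul_one] at h
  rw [fourierCoeff, integral_smul_const, h]
  by_cases hn : n = 0
  · simp [hn]
  · simp [hn]

theorem fourierCoeff_fourier_smul (f : Torus → V) (k n : ℤ) :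
    fourierCoeff (fun t => fourier k t • f t) n = fourierCoeff f (n - k) := by
  simp only [fourierCoeff, smul_smul, ← fourier_add]
  congr 1
  ext t
  congr 3
  ring

theorem fourierCoeff_comp_neg (f : Torus → V) (n : ℤ) :
    fourierCoeff (fun t => f (-t)) n = fourierCoeff f (-n) := by
  simp only [fourierCoeff]
  rw [← integral_neg_eq_self]
  congr 1
  ext t
  simp only [neg_neg]
  congr 1
  simp [fourier_apply]

theorem norm_fourierCoeff_le {f : Torus → V} {C : ℝ}
    (hC : ∀ᵐ t ∂(haarAddCircle : Measure Torus), ‖f t‖ ≤ C) (n : ℤ) : ‖fourierCoeff f n‖ ≤ C := by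
  have h := norm_integral_le_of_norm_le_const (μ := (haarAddCircle : Measure Torus))
    (f := fun t => fourier (-n) t • f t) (C := C) (by
      filter_upwards [hC] with t ht
      rwa [norm_smul, fourier_apply, Circle.norm_coe, one_mul])
  simpa [fourierCoeff] using h

theorem inner_eq_zero_of_fourierCoeff_scalar (f g : L2 ℂ)
    (h : ∀ n : ℤ, fourierCoeff (f : Torus → ℂ) n = 0 ∨ fourierCoeff (g : Torus → ℂ) n = 0) :
    ⟪f, g⟫_ℂ = 0 := by
  rw [← fourierBasis.tsum_inner_mul_inner f g]
  refine (tsum_congr fun n => ?_).trans tsum_zero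
  rw [← inner_conj_symm f, ← fourierBasis.repr_apply_apply, ← fourierBasis.repr_apply_apply,
    fourierBasis_repr, fourierBasis_repr]
  rcases h n with h | h <;> simp [h]

variable {E : Type*} [NormedAddCommGroup E] [InnerProductSpace ℂ E] [FiniteDimensional ℂ E]

/-- Parseval in each coordinate of an orthonormal basis. Disjointness of Fourier supports is the
source of all later orthogonality to `H²`. -/
theorem L2.inner_eq_zero_of_fourierCoeff [CompleteSpace E] (f g : L2 E)
    (h : ∀ n : ℤ, fourierCoeff (f : Torus → E) n = 0 ∨ fourierCoeff (g : Torus → E) n = 0) :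
    ⟪f, g⟫_ℂ = 0 := by
  let b := stdOrthonormalBasis ℂ E
  have hc : ∀ (i) (k : L2 E) (n : ℤ),
      fourierCoeff (((innerSL ℂ (b i)).compLp k : L2 ℂ) : Torus → ℂ) n
        = ⟪b i, fourierCoeff (k : Torus → E) n⟫_ℂ := by
    intro i k n
    rw [fourierCoeff_congr_ae ((innerSL ℂ (b i)).coeFn_compLp k),
      fourierCoeff_clm_comp _ ((Lp.memLp k).integrable (by norm_num))]
    rfl
  have h0 : ∀ i, ⟪(innerSL ℂ (b i)).compLp f, (innerSL ℂ (b i)).compLp g⟫_ℂ = 0 := by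
    intro i
    apply inner_eq_zero_of_fourierCoeff_scalar
    intro n
    rw [hc, hc]
    rcases h n with h | h
    · left; rw [h, inner_zero_right]
    · right; rw [h, inner_zero_right]
  rw [MeasureTheory.L2.inner_def]
  calc ∫ t, ⟪f t, g t⟫_ℂ ∂haarAddCircle
      = ∫ t, ∑ i, ⟪((innerSL ℂ (b i)).compLp f) t, ((innerSL ℂ (b i)).compLp g) t⟫_ℂ
          ∂haarAddCircle := by
        apply integral_congr_ae
        have h1 : ∀ᵐ t ∂(haarAddCircle : Measure Torus), ∀ i,
            ((innerSL ℂ (b i)).compLp f) t = ⟪b i, f t⟫_ℂ :=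
          ae_all_iff.2 fun i => (innerSL ℂ (b i)).coeFn_compLp f
        have h2 : ∀ᵐ t ∂(haarAddCircle : Measure Torus), ∀ i,
            ((innerSL ℂ (b i)).compLp g) t = ⟪b i, g t⟫_ℂ :=
          ae_all_iff.2 fun i => (innerSL ℂ (b i)).coeFn_compLp g
        filter_upwards [h1, h2] with t h1 h2
        rw [← b.sum_inner_mul_inner]
        refine Finset.sum_congr rfl fun i _ => ?_
        rw [h1, h2, RCLike.inner_apply, inner_conj_symm, mul_comm]
    _ = ∑ i, ⟪(innerSL ℂ (b i)).compLp f, (innerSL ℂ (b i)).compLp g⟫_ℂ := by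
        rw [integral_finsetSum _ fun i _ => MeasureTheory.L2.integrable_inner _ _]
        simp [MeasureTheory.L2.inner_def]
    _ = 0 := Finset.sum_eq_zero fun i _ => h0 i

theorem L2.eq_of_fourierCoeff [CompleteSpace E] {f g : L2 E}
    (h : ∀ n : ℤ, fourierCoeff (f : Torus → E) n = fourierCoeff (g : Torus → E) n) : f = g := by
  rw [← sub_eq_zero, ← inner_self_eq_zero (𝕜 := ℂ)]
  apply L2.inner_eq_zero_of_fourierCoeff
  intro n
  left
  rw [← coeffL2_apply, map_sub, coeffL2_apply, coeffL2_apply, h, sub_self]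

/-- Uniqueness of Fourier coefficients, for functions with values in a finite-dimensional space. -/
theorem ae_eq_zero_of_fourierCoeff {V : Type*} [NormedAddCommGroup V] [NormedSpace ℂ V]
    [FiniteDimensional ℂ V] {f : Torus → V} (hf : MemLp f 2 haarAddCircle)
    (h : ∀ n : ℤ, fourierCoeff f n = 0) : ∀ᵐ t ∂(haarAddCircle : Measure Torus), f t = 0 := by
  have : CompleteSpace V := FiniteDimensional.complete ℂ V
  let b := Module.finBasis ℂ V
  have key : ∀ i, ∀ᵐ t ∂(haarAddCircle : Measure Torus), b.coord i (f t) = 0 := by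
    intro i
    let L : V →L[ℂ] ℂ := (b.coord i).toContinuousLinearMap
    have h1 : L.compLp hf.toLp = 0 := by
      apply L2.eq_of_fourierCoeff
      intro n
      rw [fourierCoeff_congr_ae (L.coeFn_compLp _),
        fourierCoeff_clm_comp _ ((Lp.memLp _).integrable (by norm_num)),
        fourierCoeff_congr_ae hf.coeFn_toLp, h, map_zero, ← coeffL2_apply, map_zero]
    have h2 := L.coeFn_compLp hf.toLp
    rw [h1] at h2
    filter_upwards [h2, Lp.coeFn_zero ℂ 2 haarAddCircle, hf.coeFn_toLp] with t h2 h3 h4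
    rw [h3, h4] at h2
    exact h2.symm
  filter_upwards [ae_all_iff.2 key] with t ht
  exact b.ext_elem fun i => by simpa using ht i

end Fourier

/-! ### Boundary values of bounded analytic functions on the disc. -/

section Boundary

variable {V : Type*} [NormedAddCommGroup V] [NormedSpace ℂ V] [FiniteDimensional ℂ V]

theorem norm_circlePt (t : Torus) : ‖circlePt t‖ = 1 := Circle.norm_coe _

theorem continuous_circlePt : Continuous circlePt :=
  continuous_subtype_val.comp AddCircle.continuous_toCircle

theorem circlePt_neg (t : Torus) : circlePt (-t) = conj (circlePt t) := by
  have h := @fourier_neg (1 : ℝ) 1 t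
  simpa [circlePt, fourier_apply] using h

theorem circlePt_pow (t : Torus) (m : ℕ) : circlePt t ^ m = fourier (m : ℤ) t := by
  induction m with
  | zero => simp
  | succ m ih => rw [pow_succ, ih, Nat.cast_succ, fourier_add, fourier_one]; rfl

theorem mul_circlePt_mem_ball {r : ℝ} (hr : r ∈ Set.Ioo (0 : ℝ) 1) (t : Torus) :
    (r : ℂ) * circlePt t ∈ Metric.ball (0 : ℂ) 1 := by
  rw [mem_ball_zero_iff, norm_mul, norm_circlePt, mul_one, Complex.norm_real, Real.norm_eq_abs,
    abs_of_pos hr.1]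
  exact hr.2

/-- The Fourier coefficients of a power series on a circle of radius `r`. -/
theorem fourierCoeff_powerSeries {Θ : ℂ → V} {c : ℕ → V}
    (h : ∀ z ∈ Metric.ball (0 : ℂ) 1, HasSum (fun m => z ^ m • c m) (Θ z))
    {r : ℝ} (hr : r ∈ Set.Ioo (0 : ℝ) 1) (n : ℤ) :
    HasSum (fun m : ℕ => if n = m then (r : ℂ) ^ m • c m else 0)
      (fourierCoeff (fun t => Θ (r * circlePt t)) n) := by
  have : CompleteSpace V := FiniteDimensional.complete ℂ V
  have hnorm : ∀ (m : ℕ) (t : Torus),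
      ‖fourier (-n) t • ((r : ℂ) * circlePt t) ^ m • c m‖ = r ^ m * ‖c m‖ := by
    intro m t
    rw [norm_smul, norm_smul, fourier_apply, Circle.norm_coe, norm_pow, norm_mul, norm_circlePt,
      Complex.norm_real, Real.norm_eq_abs, abs_of_pos hr.1, one_mul, mul_one]
  have hsum : Summable fun m => r ^ m * ‖c m‖ := by
    have h1 := (h r (by
      rw [mem_ball_zero_iff, Complex.norm_real, Real.norm_eq_abs, abs_of_pos hr.1]
      exact hr.2)).summable.norm
    refine h1.congr fun m => ?_
    rw [norm_smul, norm_pow, Complex.norm_real, Real.norm_eq_abs, abs_of_pos hr.1]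
  have hint := hasSum_integral_of_summable_integral_norm
    (μ := (haarAddCircle : Measure Torus))
    (F := fun (m : ℕ) (t : Torus) => fourier (-n) t • ((r : ℂ) * circlePt t) ^ m • c m)
    (fun m => by
      apply Continuous.integrable_of_hasCompactSupport
      · have := continuous_circlePt
        have := (fourier (T := 1) (-n)).continuous
        fun_prop
      · exact HasCompactSupport.of_compactSpace _)
    (by simp only [hnorm]; simpa using hsum)
  convert! hint using 1
  · ext m
    have h1 : ∀ t : Torus, fourier (-n) t • ((r : ℂ) * circlePt t) ^ m • c m
        = (r : ℂ) ^ m • (fourier (-n) t • fourier (m : ℤ) t • c m) := by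
      intro t
      rw [mul_pow, circlePt_pow, mul_smul, smul_comm]
    simp only [h1]
    rw [integral_smul]
    have h2 := fourierCoeff_fourier_smul (fun _ : Torus => c m) m n
    rw [fourierCoeff_const'] at h2
    rw [fourierCoeff] at h2
    rw [h2]
    simp only [sub_eq_zero]
    split_ifs <;> simp
  · rw [fourierCoeff]
    congr 1
    ext t
    rw [← (h _ (mul_circlePt_mem_ball hr t)).tsum_eq]
    exact ((h _ (mul_circlePt_mem_ball hr t)).summable.tsum_const_smul _).symm

theorem Ioo_mem_nhdsLT_one : Set.Ioo (0 : ℝ) 1 ∈ 𝓝[<] (1 : ℝ) :=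
  Ioo_mem_nhdsLT one_pos

/-- The boundary function of a bounded analytic function on the disc has the Taylor coefficients
as its Fourier coefficients. -/
theorem fourierCoeff_boundary {Θ : ℂ → V} {f : Torus → V} {C : ℝ}
    (hd : DifferentiableOn ℂ Θ (Metric.ball 0 1)) (hC : ∀ z ∈ Metric.ball (0 : ℂ) 1, ‖Θ z‖ ≤ C)
    (hf : ∀ᵐ t ∂(haarAddCircle : Measure Torus),
      Tendsto (fun r : ℝ => Θ ((r : ℂ) * circlePt t)) (𝓝[<] 1) (𝓝 (f t))) :
    (∀ n : ℤ, n < 0 → fourierCoeff f n = 0) ∧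
      ∀ z ∈ Metric.ball (0 : ℂ) 1, HasSum (fun m : ℕ => z ^ m • fourierCoeff f m) (Θ z) := by
  have : CompleteSpace V := FiniteDimensional.complete ℂ V
  let c : ℕ → V := fun m => (m.factorial : ℂ)⁻¹ • iteratedDeriv m Θ 0
  have hc : ∀ z ∈ Metric.ball (0 : ℂ) 1, HasSum (fun m => z ^ m • c m) (Θ z) := by
    intro z hz
    have h := Complex.hasSum_taylorSeries_on_ball hd hz
    simp only [sub_zero] at h
    convert! h using 1
    ext m
    simp only [c]
    rw [smul_comm]
  have hlim : ∀ n : ℤ, Tendsto (fun r : ℝ => fourierCoeff (fun t => Θ (r * circlePt t)) n)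
      (𝓝[<] 1) (𝓝 (fourierCoeff f n)) := by
    intro n
    refine tendsto_integral_filter_of_dominated_convergence (fun _ => C) ?_ ?_
      (integrable_const _) ?_
    · filter_upwards [Ioo_mem_nhdsLT_one] with r hr
      apply Continuous.aestronglyMeasurable
      refine (fourier (T := 1) (-n)).continuous.smul ?_
      exact hd.continuousOn.comp_continuous (continuous_const.mul continuous_circlePt)
        (mul_circlePt_mem_ball hr)
    · filter_upwards [Ioo_mem_nhdsLT_one] with r hr
      refine Eventually.of_forall fun t => ?_
      rw [norm_smul, fourier_apply, Circle.norm_coe, one_mul]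
      exact hC _ (mul_circlePt_mem_ball hr t)
    · filter_upwards [hf] with t ht
      exact ht.const_smul _
  have hcoeff : ∀ m : ℕ, fourierCoeff f m = c m := by
    intro m
    refine tendsto_nhds_unique (hlim m) ?_
    have h1 : Tendsto (fun r : ℝ => (r : ℂ) ^ m • c m) (𝓝[<] 1) (𝓝 (c m)) := by
      have h2 : Continuous fun r : ℝ => (r : ℂ) ^ m • c m := by fun_prop
      simpa using (h2.tendsto 1).mono_left nhdsWithin_le_nhds
    refine h1.congr' ?_
    filter_upwards [Ioo_mem_nhdsLT_one] with r hr
    refine (hasSum_ite_eq m ((r : ℂ) ^ m • c m)).unique ?_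
    convert! fourierCoeff_powerSeries hc hr m using 1
    ext k
    by_cases hk : k = m
    · simp [hk]
    · have : ¬ ((m : ℤ) = k) := by omega
      simp [hk, this]
  refine ⟨fun n hn => ?_, fun z hz => ?_⟩
  · refine tendsto_nhds_unique (hlim n) ?_
    refine tendsto_const_nhds.congr' ?_
    filter_upwards [Ioo_mem_nhdsLT_one] with r hr
    refine HasSum.unique (hasSum_zero (L := SummationFilter.unconditional ℕ)) ?_
    convert! fourierCoeff_powerSeries hc hr n using 1
    ext k
    have : ¬ (n = (k : ℤ)) := by omega
    simp [this]
  · simpa only [hcoeff] using hc z hz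

/-- A bounded analytic scalar function whose boundary values lie in the closed unit disc is
bounded by one. -/
theorem norm_le_one_of_boundary {u : ℂ → ℂ} {f : Torus → ℂ} {C : ℝ}
    (hd : DifferentiableOn ℂ u (Metric.ball 0 1)) (hC : ∀ z ∈ Metric.ball (0 : ℂ) 1, ‖u z‖ ≤ C)
    (hf : ∀ᵐ t ∂(haarAddCircle : Measure Torus),
      Tendsto (fun r : ℝ => u ((r : ℂ) * circlePt t)) (𝓝[<] 1) (𝓝 (f t)))
    (h1 : ∀ᵐ t ∂(haarAddCircle : Measure Torus), ‖f t‖ ≤ 1) {z : ℂ}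
    (hz : z ∈ Metric.ball (0 : ℂ) 1) : ‖u z‖ ≤ 1 := by
  have hz' : ‖z‖ < 1 := mem_ball_zero_iff.1 hz
  -- The Taylor coefficients of `u ^ k` are Fourier coefficients of `f ^ k`, hence at most 1 in
  -- modulus, and the geometric series gives a bound independent of `k`. Powers of a number
  -- exceeding 1 would violate it.
  have key : ∀ k : ℕ, ‖u z‖ ^ k ≤ (1 - ‖z‖)⁻¹ := by
    intro k
    have h2 := (fourierCoeff_boundary (Θ := fun z => u z ^ k) (f := fun t => f t ^ k) (C := C ^ k)
      (hd.pow k) (fun z hz => by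
        rw [norm_pow]; exact pow_le_pow_left₀ (norm_nonneg _) (hC z hz) k)
      (by filter_upwards [hf] with t ht using ht.pow k)).2 z hz
    rw [← norm_pow, ← h2.tsum_eq]
    refine tsum_of_norm_bounded (hasSum_geometric_of_lt_one (norm_nonneg z) hz') fun m => ?_
    rw [norm_smul, norm_pow]
    refine mul_le_of_le_one_right (by positivity) (norm_fourierCoeff_le ?_ _)
    filter_upwards [h1] with t ht
    rw [norm_pow]
    exact pow_le_one₀ (norm_nonneg _) ht
  by_contra! hlt
  obtain ⟨k, hk⟩ := pow_unbounded_of_one_lt ((1 - ‖z‖)⁻¹) hlt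
  exact absurd (key k) (not_le.2 hk)

end Boundary

/-! ### Symbols, their adjoints, and the boundary functions of their two parts. -/

section Symbols

open ContinuousLinearMap
open scoped InnerProductSpace

variable {E F : Type*}
  [NormedAddCommGroup E] [InnerProductSpace ℂ E] [CompleteSpace E] [FiniteDimensional ℂ E]
  [NormedAddCommGroup F] [InnerProductSpace ℂ F] [CompleteSpace F] [FiniteDimensional ℂ F]

theorem LInf.integrable (Φ : LInf E F) : Integrable (Φ : Torus → E →L[ℂ] F) haarAddCircle :=
  (Lp.memLp Φ).integrable le_top

theorem LInf.memLp_two (Φ : LInf E F) : MemLp (Φ : Torus → E →L[ℂ] F) 2 haarAddCircle :=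
  (Lp.memLp Φ).mono_exponent le_top

/-- A continuous linear image of a symbol is a.e. constant as soon as its nonzero Fourier
coefficients vanish. -/
theorem LInf.clm_ae_eq {V : Type*} [NormedAddCommGroup V] [NormedSpace ℂ V]
    [FiniteDimensional ℂ V] (Φ : LInf E F) (L : (E →L[ℂ] F) →L[ℂ] V)
    (h : ∀ n : ℤ, n ≠ 0 → L (symbolCoeff Φ n) = 0) :
    ∀ᵐ t ∂(haarAddCircle : Measure Torus), L (Φ t) = L (symbolCoeff Φ 0) := by
  have : CompleteSpace V := FiniteDimensional.complete ℂ V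
  have hL : MemLp (fun t => L (Φ t)) 2 haarAddCircle := L.comp_memLp' Φ.memLp_two
  have h1 := ae_eq_zero_of_fourierCoeff (f := fun t => L (Φ t) + -L (symbolCoeff Φ 0))
    (hL.add (memLp_const _)) (fun n => by
      have h2 := fourierCoeff.add (hL.integrable (by norm_num))
        (integrable_const (μ := (haarAddCircle : Measure Torus)) (-L (symbolCoeff Φ 0)))
      have h3 := congrFun h2 n
      refine h3.trans ?_
      rw [Pi.add_apply, fourierCoeff_const', fourierCoeff_clm_comp L Φ.integrable]
      by_cases hn : n = 0
      · subst hn; simp [symbolCoeff]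
      · rw [if_neg hn, add_zero]; exact h n hn)
  filter_upwards [h1] with t ht
  rwa [← sub_eq_add_neg, sub_eq_zero] at ht

/-- Conversely, a continuous linear image that is a.e. constant has no nonzero Fourier
coefficients. -/
theorem LInf.clm_symbolCoeff_eq_zero {V : Type*} [NormedAddCommGroup V] [NormedSpace ℂ V]
    [CompleteSpace V] (Φ : LInf E F) (L : (E →L[ℂ] F) →L[ℂ] V) {v : V}
    (h : ∀ᵐ t ∂(haarAddCircle : Measure Torus), L (Φ t) = v) {n : ℤ} (hn : n ≠ 0) :
    L (symbolCoeff Φ n) = 0 := by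
  rw [symbolCoeff, ← fourierCoeff_clm_comp L Φ.integrable]
  rw [fourierCoeff_congr_ae (g := fun _ => v) h, fourierCoeff_const', if_neg hn]

theorem symbolCoeff_apply (Φ : LInf E F) (n : ℤ) (e : E) :
    symbolCoeff Φ n e = fourierCoeff (fun t => Φ t e) n :=
  (fourierCoeff_clm_comp (ContinuousLinearMap.apply ℂ F e) Φ.integrable n).symm

theorem symbolCoeff_add (Φ Ψ : LInf E F) (n : ℤ) :
    symbolCoeff (Φ + Ψ) n = symbolCoeff Φ n + symbolCoeff Ψ n := by
  rw [symbolCoeff, fourierCoeff_congr_ae (Lp.coeFn_add Φ Ψ),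
    congrFun (fourierCoeff.add Φ.integrable Ψ.integrable) n]
  rfl

/-- The constant symbol. -/
def constSymbol (A : E →L[ℂ] F) : LInf E F := Lp.const ∞ haarAddCircle A

theorem coeFn_constSymbol (A : E →L[ℂ] F) :
    ∀ᵐ t ∂(haarAddCircle : Measure Torus), constSymbol A t = A :=
  Lp.coeFn_const ..

theorem symbolCoeff_constSymbol (A : E →L[ℂ] F) (n : ℤ) :
    symbolCoeff (constSymbol A) n = if n = 0 then A else 0 := by
  rw [symbolCoeff, fourierCoeff_congr_ae (g := fun _ => A) (coeFn_constSymbol A),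
    fourierCoeff_const']

/-- The pointwise adjoint of a symbol. -/
def adjSymbol (Φ : LInf E F) : LInf F E :=
  ((adjoint : (E →L[ℂ] F) ≃ₗᵢ⋆[ℂ] (F →L[ℂ] E)).toContinuousLinearEquiv :
    (E →L[ℂ] F) →L⋆[ℂ] (F →L[ℂ] E)).compLp Φ

theorem coeFn_adjSymbol (Φ : LInf E F) :
    ∀ᵐ t ∂(haarAddCircle : Measure Torus), adjSymbol Φ t = adjoint (Φ t) :=
  ContinuousLinearMap.coeFn_compLp _ Φ

theorem symbolCoeff_adjSymbol (Φ : LInf E F) (n : ℤ) :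
    symbolCoeff (adjSymbol Φ) n = adjoint (symbolCoeff Φ (-n)) := by
  rw [symbolCoeff, fourierCoeff_congr_ae (coeFn_adjSymbol Φ)]
  exact fourierCoeff_conj_clm_comp
    ((adjoint : (E →L[ℂ] F) ≃ₗᵢ⋆[ℂ] (F →L[ℂ] E)).toContinuousLinearEquiv :
      (E →L[ℂ] F) →L⋆[ℂ] (F →L[ℂ] E)) Φ.integrable n

theorem laurent_ext {A : L2 E →L[ℂ] L2 F} {Φ : LInf E F}
    (h : ∀ f : L2 E, ∀ᵐ t ∂(haarAddCircle : Measure Torus), A f t = Φ t (f t)) :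
    A = laurent Φ := by
  ext1 f
  apply Lp.ext
  filter_upwards [h f, laurent_coeFn Φ f] with t h1 h2
  rw [h1, h2]

theorem adjoint_laurent (Φ : LInf E F) : adjoint (laurent Φ) = laurent (adjSymbol Φ) := by
  symm
  rw [eq_adjoint_iff]
  intro f g
  rw [MeasureTheory.L2.inner_def, MeasureTheory.L2.inner_def]
  apply integral_congr_ae
  filter_upwards [laurent_coeFn (adjSymbol Φ) f, laurent_coeFn Φ g, coeFn_adjSymbol Φ]
    with t h1 h2 h3
  rw [h1, h2, h3, adjoint_inner_left]

theorem adjoint_toeplitz (Φ : LInf E F) : adjoint (toeplitz Φ) = toeplitz (adjSymbol Φ) := by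
  rw [toeplitz, toeplitz, adjoint_comp, adjoint_comp, Submodule.adjoint_orthogonalProjectionOnto,
    Submodule.adjoint_subtypeL, adjoint_laurent]
  rfl

theorem HasBoundaryValues.congr {Θ Θ' : ℂ → E →L[ℂ] F} {f f' : Torus → E →L[ℂ] F}
    (h : HasBoundaryValues Θ f) (hΘ : ∀ z ∈ Metric.ball (0 : ℂ) 1, Θ z = Θ' z)
    (hf : ∀ᵐ t ∂(haarAddCircle : Measure Torus), f t = f' t) : HasBoundaryValues Θ' f' := by
  filter_upwards [h, hf] with t ht h1
  rw [← h1]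
  refine ht.congr' ?_
  filter_upwards [Ioo_mem_nhdsLT_one] with r hr
  exact hΘ _ (mul_circlePt_mem_ball hr t)

theorem HasBoundaryValues.unique {Θ : ℂ → E →L[ℂ] F} {f f' : Torus → E →L[ℂ] F}
    (h : HasBoundaryValues Θ f) (h' : HasBoundaryValues Θ f') :
    ∀ᵐ t ∂(haarAddCircle : Measure Torus), f t = f' t := by
  filter_upwards [h, h'] with t h1 h2
  exact tendsto_nhds_unique h1 h2

theorem HasBoundaryValues.add_const {Θ : ℂ → E →L[ℂ] F} {f : Torus → E →L[ℂ] F}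
    (h : HasBoundaryValues Θ f) (A : E →L[ℂ] F) :
    HasBoundaryValues (fun z => Θ z + A) (fun t => f t + A) := by
  filter_upwards [h] with t ht
  exact ht.add_const A

theorem HasBoundaryValues.adjoint {Θ : ℂ → E →L[ℂ] F} {f : Torus → E →L[ℂ] F}
    (h : HasBoundaryValues Θ f) :
    HasBoundaryValues (fun z => ContinuousLinearMap.adjoint (Θ z))
      (fun t => ContinuousLinearMap.adjoint (f t)) := by
  filter_upwards [h] with t ht
  exact ((LinearIsometryEquiv.continuous _).tendsto _).comp ht

theorem IsBoundedAnalytic.adjoint_conj {Θ : ℂ → E →L[ℂ] F} (h : IsBoundedAnalytic Θ) :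
    IsBoundedAnalytic (fun z => adjoint (Θ (conj z))) := by
  obtain ⟨hd, C, hC⟩ := h
  have hball : ∀ z ∈ Metric.ball (0 : ℂ) 1, conj z ∈ Metric.ball (0 : ℂ) 1 := by
    intro z hz
    simpa using hz
  refine ⟨fun z hz => ?_, C, fun z hz => ?_⟩
  · have h1 : DifferentiableAt ℂ Θ (conj z) :=
      (hd _ (hball z hz)).differentiableAt (Metric.isOpen_ball.mem_nhds (hball z hz))
    have h2 := h1.comp_semilinear₁ (starRingEnd ℂ)
      ((adjoint : (E →L[ℂ] F) ≃ₗᵢ⋆[ℂ] (F →L[ℂ] E)).toContinuousLinearEquiv :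
        (E →L[ℂ] F) →L⋆[ℂ] (F →L[ℂ] E))
    rw [Complex.conj_conj] at h2
    exact h2.differentiableWithinAt
  · rw [LinearIsometryEquiv.norm_map]
    exact hC _ (hball z hz)

/-- The adjoint exchanges the analytic and the co-analytic summand, so statements about the
co-analytic part follow from those about the analytic part. -/
theorem adjSymbol_mem {Φ : LInf E F} (h : Φ ∈ HInfAddHInfBar E F) :
    adjSymbol Φ ∈ HInfAddHInfBar F E := by
  obtain ⟨f, ⟨Θ, hΘ, hf⟩, g, ⟨Ψ, hΨ, hg⟩, rfl⟩ := h
  refine ⟨adjSymbol g, ⟨_, hΨ.adjoint_conj, ?_⟩, adjSymbol f, ⟨_, hΘ.adjoint_conj, ?_⟩, ?_⟩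
  · refine hg.adjoint.congr (fun z _ => rfl) ?_
    filter_upwards [coeFn_adjSymbol g] with t ht using ht.symm
  · refine hf.adjoint.congr (fun z _ => by rw [Complex.conj_conj]) ?_
    filter_upwards [coeFn_adjSymbol f] with t ht using ht.symm
  · apply Lp.ext
    filter_upwards [coeFn_adjSymbol (f + g), coeFn_adjSymbol f, coeFn_adjSymbol g,
      Lp.coeFn_add f g, Lp.coeFn_add (adjSymbol g) (adjSymbol f)] with t h1 h2 h3 h4 h5
    rw [h1, h4, h5, Pi.add_apply, Pi.add_apply, h2, h3, map_add, add_comm]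

theorem analyticPart_adjSymbol (Φ : LInf E F) (z : ℂ) :
    analyticPart (adjSymbol Φ) z = adjoint (coanalyticPart Φ z) := by
  have h := ((adjoint : (E →L[ℂ] F) ≃ₗᵢ⋆[ℂ] (F →L[ℂ] E)).toContinuousLinearEquiv).map_tsum
    (L := SummationFilter.unconditional ℕ) (f := fun m : ℕ => (conj z) ^ m • symbolCoeff Φ (-(m : ℤ)))
  refine Eq.trans ?_ h.symm
  rw [analyticPart]
  refine tsum_congr fun m => ?_
  rw [symbolCoeff_adjSymbol]
  have := (adjoint : (E →L[ℂ] F) ≃ₗᵢ⋆[ℂ] (F →L[ℂ] E)).map_smulₛₗ ((conj z) ^ m)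
    (symbolCoeff Φ (-(m : ℤ)))
  refine Eq.trans ?_ this.symm
  simp

/-- The boundary functions `P` and `M` of the analytic and co-analytic parts of a symbol. -/
structure IsBoundaryDecomposition (Φ P M : LInf E F) : Prop where
  sum : ∀ᵐ t ∂(haarAddCircle : Measure Torus), Φ t = P t + M t - symbolCoeff Φ 0
  coeff_pos : ∀ n : ℤ, 0 ≤ n → symbolCoeff P n = symbolCoeff Φ n
  coeff_pos_neg : ∀ n : ℤ, n < 0 → symbolCoeff P n = 0
  coeff_neg : ∀ n : ℤ, n ≤ 0 → symbolCoeff M n = symbolCoeff Φ n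
  coeff_neg_pos : ∀ n : ℤ, 0 < n → symbolCoeff M n = 0
  boundary_pos : HasBoundaryValues (analyticPart Φ) P
  boundary_neg : HasBoundaryValues (coanalyticPart Φ) M
  analytic : IsBoundedAnalytic (analyticPart Φ)

theorem hasSum_ite_zero_smul (z : ℂ) (A : E →L[ℂ] F) :
    HasSum (fun m : ℕ => z ^ m • if (m : ℤ) = 0 then A else 0) A := by
  convert! hasSum_ite_eq (0 : ℕ) A using 1
  ext1 m
  by_cases hm : m = 0
  · subst hm; simp
  · simp [hm]

theorem exists_boundaryDecomposition {Φ : LInf E F} (h : Φ ∈ HInfAddHInfBar E F) :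
    ∃ P M, IsBoundaryDecomposition Φ P M := by
  obtain ⟨f, ⟨Θ, ⟨hΘ, C, hC⟩, hf⟩, g, ⟨Ψ, ⟨hΨ, D, hD⟩, hg⟩, rfl⟩ := h
  obtain ⟨hf1, hf2⟩ := fourierCoeff_boundary hΘ hC hf
  -- The measure-preserving reflection `t ↦ -t` conjugates the circle and turns `g` into an ordinary
  -- boundary function of `Ψ`.
  have hg' : ∀ᵐ t ∂(haarAddCircle : Measure Torus),
      Tendsto (fun r : ℝ => Ψ ((r : ℂ) * circlePt t)) (𝓝[<] 1) (𝓝 (g (-t))) := by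
    have h1 := (Measure.measurePreserving_neg
      (haarAddCircle : Measure Torus)).quasiMeasurePreserving.ae hg
    filter_upwards [h1] with t ht
    refine ht.congr fun r => ?_
    rw [circlePt_neg, map_mul, Complex.conj_conj, Complex.conj_ofReal]
  obtain ⟨hg1, hg2⟩ := fourierCoeff_boundary hΨ hD hg'
  simp only [fourierCoeff_comp_neg] at hg1 hg2
  have hg1' : ∀ n : ℤ, 0 < n → symbolCoeff g n = 0 := by
    intro n hn
    have := hg1 (-n) (by omega)
    rwa [neg_neg] at this
  have hf1' : ∀ n : ℤ, n < 0 → symbolCoeff f n = 0 := hf1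
  have hA : ∀ z ∈ Metric.ball (0 : ℂ) 1, Θ z + symbolCoeff g 0 = analyticPart (f + g) z := by
    intro z hz
    have h1 := (hf2 z hz).add (hasSum_ite_zero_smul z (symbolCoeff g 0))
    rw [analyticPart, ← h1.tsum_eq]
    refine tsum_congr fun m => ?_
    rw [symbolCoeff_add, smul_add]
    congr 2
    split_ifs with hm
    · rw [hm]
    · exact (hg1' m (by omega)).symm
  have hB : ∀ z ∈ Metric.ball (0 : ℂ) 1,
      Ψ (conj z) + symbolCoeff f 0 = coanalyticPart (f + g) z := by
    intro z hz
    have hz' : conj z ∈ Metric.ball (0 : ℂ) 1 := by simpa using hz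
    have h1 := (hg2 _ hz').add (hasSum_ite_zero_smul (conj z) (symbolCoeff f 0))
    rw [coanalyticPart, ← h1.tsum_eq]
    refine tsum_congr fun m => ?_
    rw [symbolCoeff_add, smul_add, add_comm]
    congr 2
    split_ifs with hm
    · rw [hm, neg_zero]
    · exact (hf1' _ (by omega)).symm
  -- The mean of `Φ` is the sum of the means of `f` and `g`. Each part must carry all of it, so each
  -- summand receives the mean of the other, and the sum counts it twice.
  refine ⟨f + constSymbol (symbolCoeff g 0), g + constSymbol (symbolCoeff f 0), ?_, ?_, ?_, ?_, ?_,
    ?_, ?_, ?_⟩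
  · filter_upwards [Lp.coeFn_add f g, Lp.coeFn_add f (constSymbol (symbolCoeff g 0)),
      Lp.coeFn_add g (constSymbol (symbolCoeff f 0)), coeFn_constSymbol (symbolCoeff g 0),
      coeFn_constSymbol (symbolCoeff f 0)] with t h1 h2 h3 h4 h5
    rw [h1, h2, h3, symbolCoeff_add, Pi.add_apply, Pi.add_apply, Pi.add_apply, h4, h5]
    abel
  · intro n hn
    rw [symbolCoeff_add, symbolCoeff_add, symbolCoeff_constSymbol]
    split_ifs with h0
    · rw [h0]
    · rw [hg1' n (by omega)]
  · intro n hn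
    rw [symbolCoeff_add, symbolCoeff_constSymbol, if_neg hn.ne, hf1' n hn, add_zero]
  · intro n hn
    rw [symbolCoeff_add, symbolCoeff_add, symbolCoeff_constSymbol, add_comm]
    split_ifs with h0
    · rw [h0]
    · rw [hf1' n (by omega)]
  · intro n hn
    rw [symbolCoeff_add, symbolCoeff_constSymbol, if_neg hn.ne', hg1' n hn, add_zero]
  · refine (HasBoundaryValues.add_const hf (symbolCoeff g 0)).congr hA ?_
    filter_upwards [Lp.coeFn_add f (constSymbol (symbolCoeff g 0)),
      coeFn_constSymbol (symbolCoeff g 0)] with t h1 h2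
    rw [h1, Pi.add_apply, h2]
  · refine (HasBoundaryValues.add_const hg (symbolCoeff f 0)).congr hB ?_
    filter_upwards [Lp.coeFn_add g (constSymbol (symbolCoeff f 0)),
      coeFn_constSymbol (symbolCoeff f 0)] with t h1 h2
    rw [h1, Pi.add_apply, h2]
  · refine ⟨(hΘ.add_const _).congr fun z hz => (hA z hz).symm, C + ‖symbolCoeff g 0‖,
      fun z hz => ?_⟩
    rw [← hA z hz]
    exact (norm_add_le _ _).trans (by gcongr; exact hC z hz)

end Symbols

/-! ### Multiplication operators, the shift and Toeplitz operators on the Hardy space. -/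

section Shift

open ContinuousLinearMap
open scoped InnerProductSpace

variable {E F G : Type*}
  [NormedAddCommGroup E] [InnerProductSpace ℂ E] [CompleteSpace E] [FiniteDimensional ℂ E]
  [NormedAddCommGroup F] [InnerProductSpace ℂ F] [CompleteSpace F] [FiniteDimensional ℂ F]
  [NormedAddCommGroup G] [InnerProductSpace ℂ G] [CompleteSpace G] [FiniteDimensional ℂ G]

/-- The pointwise product of two symbols. -/
def mulSymbol (Φ : LInf F G) (Ψ : LInf E F) : LInf E G :=
  (ContinuousLinearMap.compL ℂ E F G).holder ∞ Φ Ψ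

theorem coeFn_mulSymbol (Φ : LInf F G) (Ψ : LInf E F) :
    ∀ᵐ t ∂(haarAddCircle : Measure Torus), mulSymbol Φ Ψ t = Φ t ∘L Ψ t :=
  ContinuousLinearMap.coeFn_holder _ Φ Ψ

theorem laurent_mulSymbol (Φ : LInf F G) (Ψ : LInf E F) :
    laurent (mulSymbol Φ Ψ) = laurent Φ ∘L laurent Ψ := by
  symm
  apply laurent_ext
  intro f
  filter_upwards [laurent_coeFn Φ (laurent Ψ f), laurent_coeFn Ψ f, coeFn_mulSymbol Φ Ψ]
    with t h1 h2 h3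
  rw [h3, comp_apply, comp_apply, h1, h2]

variable (E) in
/-- The scalar symbol `ζ ^ n`. -/
def fourierSymbol (n : ℤ) : LInf E E :=
  MemLp.toLp (fun t : Torus => fourier n t • ContinuousLinearMap.id ℂ E)
    (memLp_top_of_bound
      ((fourier (T := 1) n).continuous.smul continuous_const).aestronglyMeasurable
      ‖ContinuousLinearMap.id ℂ E‖ (Eventually.of_forall fun t => by
        rw [norm_smul, fourier_apply, Circle.norm_coe, one_mul]))

variable (E) in
/-- Multiplication by `ζ ^ n` on `L²`. -/
def modulate (n : ℤ) : L2 E →L[ℂ] L2 E := laurent (fourierSymbol E n)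

theorem coeFn_modulate (n : ℤ) (f : L2 E) :
    ∀ᵐ t ∂(haarAddCircle : Measure Torus), modulate E n f t = fourier n t • f t := by
  have h : ∀ᵐ t ∂(haarAddCircle : Measure Torus),
      fourierSymbol E n t = fourier n t • ContinuousLinearMap.id ℂ E := MemLp.coeFn_toLp _
  filter_upwards [laurent_coeFn (fourierSymbol E n) f, h] with t h1 h2
  rw [modulate, h1, h2]
  rfl

theorem fourierCoeff_modulate (k n : ℤ) (f : L2 E) :
    fourierCoeff (modulate E k f : Torus → E) n = fourierCoeff (f : Torus → E) (n - k) := by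
  rw [fourierCoeff_congr_ae (coeFn_modulate k f), fourierCoeff_fourier_smul]

theorem modulate_zero (f : L2 E) : modulate E 0 f = f := by
  apply Lp.ext
  filter_upwards [coeFn_modulate 0 f] with t h1
  rw [h1, fourier_zero, one_smul]

theorem modulate_add (m n : ℤ) (f : L2 E) :
    modulate E (m + n) f = modulate E m (modulate E n f) := by
  apply Lp.ext
  filter_upwards [coeFn_modulate (m + n) f, coeFn_modulate m (modulate E n f),
    coeFn_modulate n f] with t h1 h2 h3
  rw [h1, h2, h3, fourier_add, mul_smul]

theorem inner_modulate (n : ℤ) (f g : L2 E) :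
    ⟪modulate E n f, g⟫_ℂ = ⟪f, modulate E (-n) g⟫_ℂ := by
  rw [MeasureTheory.L2.inner_def, MeasureTheory.L2.inner_def]
  apply integral_congr_ae
  filter_upwards [coeFn_modulate n f, coeFn_modulate (-n) g] with t h1 h2
  rw [h1, h2, inner_smul_left, inner_smul_right, fourier_neg]

theorem inner_modulate_modulate (n : ℤ) (f g : L2 E) :
    ⟪modulate E n f, modulate E n g⟫_ℂ = ⟪f, g⟫_ℂ := by
  rw [inner_modulate, ← modulate_add, neg_add_cancel, modulate_zero]

theorem norm_modulate (n : ℤ) (f : L2 E) : ‖modulate E n f‖ = ‖f‖ := by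
  rw [@norm_eq_sqrt_re_inner ℂ, @norm_eq_sqrt_re_inner ℂ, inner_modulate_modulate]

theorem laurent_modulate (Φ : LInf E F) (n : ℤ) (f : L2 E) :
    laurent Φ (modulate E n f) = modulate F n (laurent Φ f) := by
  apply Lp.ext
  filter_upwards [laurent_coeFn Φ (modulate E n f), coeFn_modulate n f,
    coeFn_modulate n (laurent Φ f), laurent_coeFn Φ f] with t h1 h2 h3 h4
  rw [h1, h2, h3, h4, map_smul]

/-- The constant function with value `e`. -/
abbrev constL2 (e : E) : L2 E := Lp.const 2 haarAddCircle e

theorem coeFn_constL2 (e : E) :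
    ∀ᵐ t ∂(haarAddCircle : Measure Torus), constL2 e t = e := Lp.coeFn_const ..

theorem fourierCoeff_constL2 (e : E) (n : ℤ) :
    fourierCoeff (constL2 e : Torus → E) n = if n = 0 then e else 0 := by
  rw [fourierCoeff_congr_ae (g := fun _ => e) (coeFn_constL2 e), fourierCoeff_const']

theorem norm_constL2 (e : E) : ‖constL2 e‖ = ‖e‖ := by
  refine (Lp.norm_const' (p := 2) (μ := (haarAddCircle : Measure Torus)) (c := e)
    (by norm_num) (by norm_num)).trans ?_
  simp

theorem inner_constL2 (e : E) (f : L2 E) :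
    ⟪constL2 e, f⟫_ℂ = ⟪e, fourierCoeff (f : Torus → E) 0⟫_ℂ := by
  have h : Integrable (fun t => fourier (-0) t • f t) haarAddCircle :=
    ((Lp.memLp f).integrable (by norm_num)).fourier_smul _
  rw [MeasureTheory.L2.inner_def, fourierCoeff, ← integral_inner h]
  apply integral_congr_ae
  filter_upwards [coeFn_constL2 e] with t ht
  rw [ht, neg_zero, fourier_zero, one_smul]

theorem inner_modulate_constL2 (n : ℤ) (e : E) (f : L2 E) :
    ⟪modulate E n (constL2 e), f⟫_ℂ = ⟪e, fourierCoeff (f : Torus → E) n⟫_ℂ := by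
  rw [inner_modulate, inner_constL2, fourierCoeff_modulate, zero_sub, neg_neg]

theorem fourierCoeff_laurent_constL2 (Φ : LInf E F) (e : E) (n : ℤ) :
    fourierCoeff (laurent Φ (constL2 e) : Torus → F) n = symbolCoeff Φ n e := by
  rw [symbolCoeff_apply]
  refine congrFun (fourierCoeff_congr_ae ?_) n
  filter_upwards [laurent_coeFn Φ (constL2 e), coeFn_constL2 e] with t h1 h2
  rw [h1, h2]

theorem modulate_constL2_mem_H2 (n : ℕ) (e : E) : modulate E n (constL2 e) ∈ H2 E := by
  intro k hk
  rw [fourierCoeff_modulate, fourierCoeff_constL2, if_neg (by omega)]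

theorem constL2_mem_H2 (e : E) : constL2 e ∈ H2 E := by
  simpa [modulate_zero] using modulate_constL2_mem_H2 0 e

theorem modulate_mem_H2 (n : ℕ) {f : L2 E} (hf : f ∈ H2 E) : modulate E n f ∈ H2 E := by
  intro k hk
  rw [fourierCoeff_modulate]
  exact hf _ (by omega)

theorem mem_H2_orthogonal_iff {f : L2 E} :
    f ∈ (H2 E)ᗮ ↔ ∀ n : ℤ, 0 ≤ n → fourierCoeff (f : Torus → E) n = 0 := by
  constructor
  · intro hf n hn
    obtain ⟨k, rfl⟩ := Int.eq_ofNat_of_zero_le hn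
    refine ext_inner_left ℂ fun e => ?_
    rw [inner_zero_right, ← inner_modulate_constL2]
    exact hf _ (modulate_constL2_mem_H2 k e)
  · intro h g hg
    apply L2.inner_eq_zero_of_fourierCoeff
    intro n
    rcases lt_or_ge n 0 with hn | hn
    · exact Or.inl (hg n hn)
    · exact Or.inr (h n hn)

theorem fourierCoeff_sub_L2 (f g : L2 E) (n : ℤ) :
    fourierCoeff (f - g : L2 E) n = fourierCoeff (f : Torus → E) n - fourierCoeff g n := by
  rw [← coeffL2_apply, ← coeffL2_apply, ← coeffL2_apply, map_sub]

theorem fourierCoeff_starProjection_H2 (f : L2 E) {n : ℤ} (hn : 0 ≤ n) :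
    fourierCoeff ((H2 E).starProjection f : Torus → E) n = fourierCoeff (f : Torus → E) n := by
  have h := mem_H2_orthogonal_iff.1 ((H2 E).sub_starProjection_mem_orthogonal f) n hn
  rw [fourierCoeff_sub_L2, sub_eq_zero] at h
  exact h.symm

variable (E) in
/-- The unilateral shift. -/
def shift : H2 E →L[ℂ] H2 E :=
  (modulate E 1 ∘L (H2 E).subtypeL).codRestrict (H2 E) fun f => modulate_mem_H2 1 f.2

theorem coe_shift (f : H2 E) : (shift E f : L2 E) = modulate E 1 f := rfl

theorem coe_shift_pow (n : ℕ) (f : H2 E) : ((shift E ^ n) f : L2 E) = modulate E n f := by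
  induction n with
  | zero => simp [modulate_zero]
  | succ n ih =>
    rw [pow_succ', Nat.cast_succ, add_comm, modulate_add, ← ih]
    rfl

theorem norm_shift (f : H2 E) : ‖shift E f‖ = ‖f‖ := norm_modulate 1 (f : L2 E)

theorem coe_toeplitz (Φ : LInf E F) (f : H2 E) :
    (toeplitz Φ f : L2 F) = (H2 F).starProjection (laurent Φ f) := rfl

theorem inner_toeplitz (Φ : LInf E F) (f : H2 E) (g : H2 F) :
    ⟪g, toeplitz Φ f⟫_ℂ = ⟪(g : L2 F), laurent Φ f⟫_ℂ := by
  exact Submodule.inner_orthogonalProjectionOnto_eq_of_mem_left g (laurent Φ f)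

/-- The Toeplitz equation: multiplication by `Φ` commutes with multiplication by `ζ`, which is
unitary on `L²`. -/
theorem adjoint_shift_toeplitz_shift (Φ : LInf E F) (f : H2 E) :
    adjoint (shift F) (toeplitz Φ (shift E f)) = toeplitz Φ f := by
  refine ext_inner_left ℂ fun g => ?_
  rw [adjoint_inner_right, inner_toeplitz, inner_toeplitz, coe_shift, coe_shift,
    laurent_modulate, inner_modulate_modulate]

/-- The constant function with value `e`, in the Hardy space. -/
def constH2 (e : E) : H2 E := ⟨constL2 e, constL2_mem_H2 e⟩

theorem inner_shift_constH2 (f : H2 E) (e : E) : ⟪shift E f, constH2 e⟫_ℂ = 0 := by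
  show ⟪modulate E 1 f, constL2 e⟫_ℂ = 0
  apply L2.inner_eq_zero_of_fourierCoeff
  intro n
  by_cases hn : n = 0
  · left
    rw [fourierCoeff_modulate]
    exact f.2 _ (by omega)
  · right
    rw [fourierCoeff_constL2, if_neg hn]

theorem fourierCoeff_toeplitz_shift_pow (Φ : LInf E F) (e : E) (n : ℕ) {k : ℤ} (hk : 0 ≤ k) :
    fourierCoeff (toeplitz Φ ((shift E ^ n) (constH2 e)) : L2 F) k = symbolCoeff Φ (k - n) e := by
  rw [coe_toeplitz, fourierCoeff_starProjection_H2 _ hk, coe_shift_pow, laurent_modulate,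
    fourierCoeff_modulate]
  exact fourierCoeff_laurent_constL2 Φ e _

/-! ### Necessity of the two conditions. -/

theorem toeplitz_inner_eq_zero {Φ : LInf E F} (hT : IsPartialIsometry (toeplitz Φ)) (h : H2 E)
    (e : E) (m : ℕ) :
    ⟪(shift F ^ (m + 1)) (toeplitz Φ h), toeplitz Φ (constH2 e)⟫_ℂ = 0 :=
  IsPartialIsometry.toeplitz_inner_eq_zero (S := shift E) (S' := shift F) (T := toeplitz Φ)
    norm_shift norm_shift (adjoint_shift_toeplitz_shift Φ) hT
    (c := constH2 e) (fun x => inner_shift_constH2 x e) h m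

theorem symbolCoeff_orthogonal {Φ : LInf E F} (hT : IsPartialIsometry (toeplitz Φ)) (m n : ℕ) :
    adjoint (symbolCoeff Φ ((m + 1 : ℕ) : ℤ)) ∘L symbolCoeff Φ (-((n + 1 : ℕ) : ℤ)) = 0 := by
  ext1 e
  refine ext_inner_right ℂ fun e' => ?_
  rw [comp_apply, adjoint_inner_left, zero_apply, inner_zero_left]
  set x := symbolCoeff Φ (-((n + 1 : ℕ) : ℤ)) e with hx
  -- The failure of `T` to commute with the shift on `ζ ^ n e` is exactly the coefficient that
  -- enters at index 0, namely `Φ̂(-(n + 1)) e`.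
  have hD : constH2 x = toeplitz Φ ((shift E ^ (n + 1)) (constH2 e))
      - shift F (toeplitz Φ ((shift E ^ n) (constH2 e))) := by
    apply Subtype.ext
    apply L2.eq_of_fourierCoeff
    intro k
    show fourierCoeff (constL2 x : Torus → F) k
      = fourierCoeff ((toeplitz Φ ((shift E ^ (n + 1)) (constH2 e)) : L2 F)
        - (shift F (toeplitz Φ ((shift E ^ n) (constH2 e))) : L2 F) : L2 F) k
    rw [fourierCoeff_sub_L2, coe_shift, fourierCoeff_modulate, fourierCoeff_constL2]
    rcases lt_trichotomy k 0 with hk | hk | hk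
    · rw [if_neg hk.ne, (toeplitz Φ _).2 k hk, (toeplitz Φ _).2 (k - 1) (by omega), sub_zero]
    · rw [if_pos hk, fourierCoeff_toeplitz_shift_pow _ _ _ hk.ge,
        (toeplitz Φ _).2 (k - 1) (by omega), sub_zero, hx, hk, zero_sub]
    · rw [if_neg hk.ne', fourierCoeff_toeplitz_shift_pow _ _ _ hk.le,
        fourierCoeff_toeplitz_shift_pow _ _ _ (by omega), eq_comm, sub_eq_zero]
      congr 2
      push_cast
      ring
  have h1 : ⟪x, symbolCoeff Φ ((m + 1 : ℕ) : ℤ) e'⟫_ℂ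
      = ⟪(shift F ^ (m + 1)) (constH2 x), toeplitz Φ (constH2 e')⟫_ℂ := by
    rw [inner_toeplitz, coe_shift_pow, ← fourierCoeff_laurent_constL2, ← inner_modulate_constL2]
    rfl
  -- After shifting by `m + 1`, the two terms of `hD` are `S ^ (m + 1)` and `S ^ (m + 2)` of vectors
  -- in the range of `T`, so both are orthogonal to `T e'`.
  rw [h1, hD, map_sub, inner_sub_left, toeplitz_inner_eq_zero hT]
  have h2 := toeplitz_inner_eq_zero hT ((shift E ^ n) (constH2 e)) e' (m + 1)
  rw [pow_succ] at h2
  rw [zero_sub, neg_eq_zero]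
  exact h2

theorem coe_toeplitz_constH2 {Φ P M : LInf E F} (h : IsBoundaryDecomposition Φ P M) (e : E) :
    (toeplitz Φ (constH2 e) : L2 F) = laurent P (constL2 e) := by
  apply L2.eq_of_fourierCoeff
  intro n
  rw [fourierCoeff_laurent_constL2]
  rcases lt_or_ge n 0 with hn | hn
  · rw [(toeplitz Φ _).2 n hn, h.coeff_pos_neg n hn, zero_apply]
  · have h1 := fourierCoeff_toeplitz_shift_pow Φ e 0 hn
    rw [h.coeff_pos n hn]
    simpa using h1

/-- Since `T e = P e` on constants, the coefficients of `P* P` are correlations of shifted vectors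
in the range of `T`; `ae_gram_eq` shows that those of nonzero index vanish. -/
theorem symbolCoeff_gram {Φ P M : LInf E F} (h : IsBoundaryDecomposition Φ P M) (e e' : E)
    (n : ℤ) :
    ⟪e, symbolCoeff (mulSymbol (adjSymbol P) P) n e'⟫_ℂ
      = ⟪modulate F n (toeplitz Φ (constH2 e) : L2 F), (toeplitz Φ (constH2 e') : L2 F)⟫_ℂ := by
  rw [coe_toeplitz_constH2 h, coe_toeplitz_constH2 h, ← fourierCoeff_laurent_constL2,
    ← inner_modulate_constL2, laurent_mulSymbol, ← adjoint_laurent, comp_apply,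
    adjoint_inner_right, laurent_modulate]

theorem ae_gram_eq {Φ P M : LInf E F} (h : IsBoundaryDecomposition Φ P M)
    (hT : IsPartialIsometry (toeplitz Φ)) :
    ∀ᵐ t ∂(haarAddCircle : Measure Torus),
      adjoint (P t) ∘L P t = symbolCoeff (mulSymbol (adjSymbol P) P) 0 := by
  have key : ∀ (m : ℕ) (e e' : E), ⟪modulate F ((m + 1 : ℕ) : ℤ)
      (toeplitz Φ (constH2 e) : L2 F), (toeplitz Φ (constH2 e') : L2 F)⟫_ℂ = 0 := by
    intro m e e'
    rw [← coe_shift_pow]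
    exact toeplitz_inner_eq_zero hT _ e' m
  have h1 := (mulSymbol (adjSymbol P) P).clm_ae_eq (ContinuousLinearMap.id ℂ _) (by
    intro n hn
    ext1 e'
    refine ext_inner_left ℂ fun e => ?_
    rw [id_apply, zero_apply, inner_zero_right, symbolCoeff_gram h]
    rcases lt_or_gt_of_ne hn with hn | hn
    · obtain ⟨m, hm⟩ : ∃ m : ℕ, -n = ((m + 1 : ℕ) : ℤ) := ⟨(-n - 1).toNat, by omega⟩
      rw [inner_modulate, hm, ← inner_conj_symm, key, map_zero]
    · obtain ⟨m, hm⟩ : ∃ m : ℕ, n = ((m + 1 : ℕ) : ℤ) := ⟨(n - 1).toNat, by omega⟩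
      rw [hm, key])
  filter_upwards [h1, coeFn_mulSymbol (adjSymbol P) P, coeFn_adjSymbol P] with t h1 h2 h3
  rw [← h3, ← h2]
  exact h1

/-- As `P* P` is constant, the pointwise norm of `P e` equals the `L²` norm of `T e`, and `T` is a
contraction. -/
theorem ae_norm_apply_le {Φ P M : LInf E F} (h : IsBoundaryDecomposition Φ P M)
    (hT : IsPartialIsometry (toeplitz Φ)) (e : E) :
    ∀ᵐ t ∂(haarAddCircle : Measure Torus), ‖P t e‖ ≤ ‖e‖ := by
  filter_upwards [ae_gram_eq h hT] with t ht
  have h1 : ⟪P t e, P t e⟫_ℂ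
      = ⟪(toeplitz Φ (constH2 e) : L2 F), (toeplitz Φ (constH2 e) : L2 F)⟫_ℂ := by
    have h2 := symbolCoeff_gram h e e 0
    rw [modulate_zero, ← ht, comp_apply, adjoint_inner_right] at h2
    exact h2
  have h2 : ‖P t e‖ = ‖toeplitz Φ (constH2 e)‖ := by
    rw [@norm_eq_sqrt_re_inner ℂ, h1, ← @norm_eq_sqrt_re_inner ℂ]
    rfl
  calc ‖P t e‖ = ‖toeplitz Φ (constH2 e)‖ := h2
    _ ≤ 1 * ‖constH2 e‖ := (toeplitz Φ).le_of_opNorm_le hT.norm_le_one _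
    _ = ‖e‖ := by rw [one_mul]; exact norm_constL2 e

theorem isContractiveAnalytic_of_boundary {Θ : ℂ → E →L[ℂ] F} {f : Torus → E →L[ℂ] F}
    (hΘ : IsBoundedAnalytic Θ) (hf : HasBoundaryValues Θ f)
    (h1 : ∀ e, ∀ᵐ t ∂(haarAddCircle : Measure Torus), ‖f t e‖ ≤ ‖e‖) :
    IsContractiveAnalytic Θ := by
  refine ⟨hΘ.1, fun z hz a => ?_⟩
  obtain ⟨hd, C, hC⟩ := hΘ
  rcases eq_or_ne a 0 with rfl | ha
  · simp
  rcases eq_or_ne (Θ z a) 0 with h0 | h0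
  · rw [h0, norm_zero]; exact norm_nonneg a
  have ha' : 0 < ‖a‖ := norm_pos_iff.2 ha
  have h0' : 0 < ‖Θ z a‖ := norm_pos_iff.2 h0
  -- Reduction to the scalar maximum principle: `L` is normalized so that `L (Θ z) = ‖Θ z a‖ / ‖a‖`,
  -- while Cauchy–Schwarz bounds it by 1 on the boundary values.
  let L : (E →L[ℂ] F) →L[ℂ] ℂ :=
    (((‖Θ z a‖ * ‖a‖)⁻¹ : ℝ) : ℂ) • (innerSL ℂ (Θ z a) ∘L ContinuousLinearMap.apply ℂ F a)
  have hL : ∀ A : E →L[ℂ] F, ‖L A‖ ≤ ‖A a‖ / ‖a‖ := by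
    intro A
    have h2 : L A = (((‖Θ z a‖ * ‖a‖)⁻¹ : ℝ) : ℂ) * ⟪Θ z a, A a⟫_ℂ := rfl
    rw [h2, norm_mul, Complex.norm_real, Real.norm_of_nonneg (by positivity)]
    calc (‖Θ z a‖ * ‖a‖)⁻¹ * ‖⟪Θ z a, A a⟫_ℂ‖
        ≤ (‖Θ z a‖ * ‖a‖)⁻¹ * (‖Θ z a‖ * ‖A a‖) := by gcongr; exact norm_inner_le_norm _ _
      _ = ‖A a‖ / ‖a‖ := by field_simp
  have h3 : ‖L (Θ z)‖ ≤ 1 := by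
    refine norm_le_one_of_boundary (u := fun w => L (Θ w)) (f := fun t => L (f t))
      (C := ‖L‖ * C) (L.differentiable.comp_differentiableOn hd) (fun w hw => ?_) ?_ ?_ hz
    · exact (L.le_opNorm _).trans (by gcongr; exact hC w hw)
    · filter_upwards [hf] with t ht
      exact (L.continuous.tendsto _).comp ht
    · filter_upwards [h1 a] with t ht
      exact (hL _).trans ((div_le_one ha').2 ht)
  have h4 : L (Θ z) = ((‖Θ z a‖ / ‖a‖ : ℝ) : ℂ) := by
    have h2 : L (Θ z) = (((‖Θ z a‖ * ‖a‖)⁻¹ : ℝ) : ℂ) * ⟪Θ z a, Θ z a⟫_ℂ := rfl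
    rw [h2, inner_self_eq_norm_sq_to_K]
    push_cast
    have : (‖Θ z a‖ : ℂ) ≠ 0 := by exact_mod_cast h0'.ne'
    have : (‖a‖ : ℂ) ≠ 0 := by exact_mod_cast ha'.ne'
    simp only [Complex.coe_algebraMap]
    field_simp
  rw [h4, Complex.norm_real, Real.norm_of_nonneg (by positivity), div_le_one ha'] at h3
  exact h3

theorem analyticPart_of_isPartialIsometry {Φ : LInf E F} (hA : Φ ∈ HInfAddHInfBar E F)
    (hT : IsPartialIsometry (toeplitz Φ)) :
    IsContractiveAnalytic (analyticPart Φ) ∧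
      ∃ f : Torus → E →L[ℂ] F, HasBoundaryValues (analyticPart Φ) f ∧
        IsAEConstant (fun t => adjoint (f t) ∘L f t) := by
  obtain ⟨P, M, h⟩ := exists_boundaryDecomposition hA
  exact ⟨isContractiveAnalytic_of_boundary h.analytic h.boundary_pos (ae_norm_apply_le h hT),
    P, h.boundary_pos, _, ae_gram_eq h hT⟩

theorem conditions_of_isPartialIsometry {Φ : LInf E F} (hA : Φ ∈ HInfAddHInfBar E F)
    (hT : IsPartialIsometry (toeplitz Φ)) :
    ((IsContractiveAnalytic (analyticPart Φ) ∧
          ∃ f : Torus → E →L[ℂ] F, HasBoundaryValues (analyticPart Φ) f ∧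
            IsAEConstant (fun t => adjoint (f t) ∘L f t)) ∧
        (IsContractiveAnalytic (fun z => adjoint (coanalyticPart Φ z)) ∧
          ∃ g : Torus → E →L[ℂ] F, HasBoundaryValues (coanalyticPart Φ) g ∧
            IsAEConstant (fun t => g t ∘L adjoint (g t)))) ∧
      (∀ m n : ℕ, 1 ≤ m → 1 ≤ n →
        adjoint (symbolCoeff Φ (m : ℤ)) ∘L symbolCoeff Φ (-(n : ℤ)) = 0 ∧
        symbolCoeff Φ (-(n : ℤ)) ∘L adjoint (symbolCoeff Φ (m : ℤ)) = 0) := by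
  have hT' : IsPartialIsometry (toeplitz (adjSymbol Φ)) := by
    rw [← adjoint_toeplitz]
    exact isPartialIsometry_adjoint hT
  refine ⟨⟨analyticPart_of_isPartialIsometry hA hT, ?_⟩, ?_⟩
  · have h1 := analyticPart_of_isPartialIsometry (adjSymbol_mem hA) hT'
    rw [funext (analyticPart_adjSymbol Φ)] at h1
    obtain ⟨h2, f, hf, hc⟩ := h1
    refine ⟨h2, fun t => adjoint (f t), ?_, ?_⟩
    · simpa only [adjoint_adjoint] using hf.adjoint
    · simpa only [adjoint_adjoint] using hc
  · intro m n hm hn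
    obtain ⟨m, rfl⟩ := Nat.exists_eq_add_of_le' hm
    obtain ⟨n, rfl⟩ := Nat.exists_eq_add_of_le' hn
    refine ⟨symbolCoeff_orthogonal hT m n, ?_⟩
    have h := symbolCoeff_orthogonal hT' n m
    rwa [symbolCoeff_adjSymbol, symbolCoeff_adjSymbol, adjoint_adjoint, neg_neg] at h

end Shift

/-! ### Operator algebra behind sufficiency: range projections and split relations. -/

section Converse

open ContinuousLinearMap
open scoped InnerProductSpace

variable {E F G : Type*}
  [NormedAddCommGroup E] [InnerProductSpace ℂ E] [CompleteSpace E] [FiniteDimensional ℂ E]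
  [NormedAddCommGroup F] [InnerProductSpace ℂ F] [CompleteSpace F] [FiniteDimensional ℂ F]
  [NormedAddCommGroup G] [InnerProductSpace ℂ G] [CompleteSpace G] [FiniteDimensional ℂ G]

/-- The orthogonal projection onto the span of the ranges of a family of operators. -/
def rangeProj {ι : Type*} (B : ι → E →L[ℂ] F) : F →L[ℂ] F :=
  (⨆ i, LinearMap.range (B i : E →ₗ[ℂ] F)).starProjection

theorem adjoint_rangeProj {ι : Type*} (B : ι → E →L[ℂ] F) :
    adjoint (rangeProj B) = rangeProj B :=
  (isSelfAdjoint_starProjection _).adjoint_eq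

theorem rangeProj_rangeProj {ι : Type*} (B : ι → E →L[ℂ] F) (x : F) :
    rangeProj B (rangeProj B x) = rangeProj B x :=
  Submodule.starProjection_eq_self_iff.2 (Submodule.starProjection_apply_mem _ _)

theorem rangeProj_comp {ι : Type*} (B : ι → E →L[ℂ] F) (i : ι) : rangeProj B ∘L B i = B i := by
  ext1 x
  exact Submodule.starProjection_eq_self_iff.2
    (Submodule.mem_iSup_of_mem i (LinearMap.mem_range_self (B i : E →ₗ[ℂ] F) x))

theorem comp_rangeProj_eq_zero {ι : Type*} (B : ι → E →L[ℂ] F) {X : F →L[ℂ] G}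
    (h : ∀ i, X ∘L B i = 0) : X ∘L rangeProj B = 0 := by
  ext1 x
  have hle : (⨆ i, LinearMap.range (B i : E →ₗ[ℂ] F)) ≤ LinearMap.ker (X : F →ₗ[ℂ] G) := by
    refine iSup_le fun i => ?_
    rintro _ ⟨y, rfl⟩
    exact congrArg (fun A => A y) (h i)
  exact hle (Submodule.starProjection_apply_mem _ x)

theorem adjoint_comp_eq_zero {A : F →L[ℂ] G} {B : E →L[ℂ] F} (h : A ∘L B = 0) :
    adjoint B ∘L adjoint A = 0 := by
  rw [← adjoint_comp, h, map_zero]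

section Decomposition

variable {Φ P M : LInf E F} {V : Type*} [NormedAddCommGroup V] [NormedSpace ℂ V]
  [FiniteDimensional ℂ V]

theorem IsBoundaryDecomposition.clm_pos (h : IsBoundaryDecomposition Φ P M)
    (L : (E →L[ℂ] F) →L[ℂ] V) (hL : ∀ m : ℕ, L (symbolCoeff Φ ((m + 1 : ℕ) : ℤ)) = 0) :
    ∀ᵐ t ∂(haarAddCircle : Measure Torus), L (P t) = L (symbolCoeff Φ 0) := by
  rw [← h.coeff_pos 0 le_rfl]
  refine P.clm_ae_eq L fun n hn => ?_
  rcases lt_or_gt_of_ne hn with hn | hn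
  · rw [h.coeff_pos_neg n hn, map_zero]
  · obtain ⟨m, rfl⟩ : ∃ m : ℕ, n = ((m + 1 : ℕ) : ℤ) := ⟨(n - 1).toNat, by omega⟩
    rw [h.coeff_pos _ hn.le, hL]

theorem IsBoundaryDecomposition.clm_neg (h : IsBoundaryDecomposition Φ P M)
    (L : (E →L[ℂ] F) →L[ℂ] V) (hL : ∀ m : ℕ, L (symbolCoeff Φ (-((m + 1 : ℕ) : ℤ))) = 0) :
    ∀ᵐ t ∂(haarAddCircle : Measure Torus), L (M t) = L (symbolCoeff Φ 0) := by
  rw [← h.coeff_neg 0 le_rfl]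
  refine M.clm_ae_eq L fun n hn => ?_
  rcases lt_or_gt_of_ne hn with hn | hn
  · obtain ⟨m, rfl⟩ : ∃ m : ℕ, n = -((m + 1 : ℕ) : ℤ) := ⟨(-n - 1).toNat, by omega⟩
    rw [h.coeff_neg _ hn.le, hL]
  · rw [h.coeff_neg_pos n hn, map_zero]

theorem IsBoundaryDecomposition.clm_coeff_pos (h : IsBoundaryDecomposition Φ P M)
    (L : (E →L[ℂ] F) →L[ℂ] V) {v : V}
    (hL : ∀ᵐ t ∂(haarAddCircle : Measure Torus), L (P t) = v) (m : ℕ) :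
    L (symbolCoeff Φ ((m + 1 : ℕ) : ℤ)) = 0 := by
  have : CompleteSpace V := FiniteDimensional.complete ℂ V
  rw [← h.coeff_pos _ (by omega)]
  exact P.clm_symbolCoeff_eq_zero L hL (by omega)

theorem IsBoundaryDecomposition.clm_coeff_neg (h : IsBoundaryDecomposition Φ P M)
    (L : (E →L[ℂ] F) →L[ℂ] V) {v : V}
    (hL : ∀ᵐ t ∂(haarAddCircle : Measure Torus), L (M t) = v) (m : ℕ) :
    L (symbolCoeff Φ (-((m + 1 : ℕ) : ℤ))) = 0 := by
  have : CompleteSpace V := FiniteDimensional.complete ℂ V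
  rw [← h.coeff_neg _ (by omega)]
  exact M.clm_symbolCoeff_eq_zero L hL (by omega)

end Decomposition

/-- Pointwise relations between the boundary values `p`, `m` of the analytic and co-analytic parts,
the mean value `p₀`, and the projections `π`, `ρ` onto the initial and final spaces of the
co-analytic coefficients. -/
structure SplitRelations (p m p₀ : E →L[ℂ] F) (π : E →L[ℂ] E) (ρ : F →L[ℂ] F) : Prop where
  pos_comp : p ∘L π = p₀ ∘L π
  neg_comp : m - m ∘L π = p₀ - p₀ ∘L π
  comp_neg : m - ρ ∘L m = p₀ - ρ ∘L p₀
  comp_pos : ρ ∘L p = ρ ∘L p₀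

section Split

variable {p m p₀ : E →L[ℂ] F} {π : E →L[ℂ] E} {ρ : F →L[ℂ] F}

/-- This is `(m - p₀)* (p - p₀) = 0`: by `comp_neg` and `comp_pos`, `m - p₀` has range in that of
`ρ`, whereas `ρ` annihilates `p - p₀`. The next two lemmas are `(p - p₀)* (m - p₀) = 0` and, with
`π` in place of `ρ`, `(p - p₀) (m - p₀)* = 0`. -/
theorem SplitRelations.adjoint_neg_pos (h : SplitRelations p m p₀ π ρ) (hρ : adjoint ρ = ρ)
    (x : E) : adjoint m (p x) - adjoint m (p₀ x) = adjoint p₀ (p x) - adjoint p₀ (p₀ x) := by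
  have h1 : ∀ y, adjoint m y - adjoint m (ρ y) = adjoint p₀ y - adjoint p₀ (ρ y) := by
    intro y
    have := congrArg (fun A => adjoint A y) h.comp_neg
    simpa only [map_sub, adjoint_comp, hρ, sub_apply, comp_apply] using this
  have h2 : ρ (p x) = ρ (p₀ x) := congrArg (fun A => A x) h.comp_pos
  have h3 := h1 (p x)
  have h4 := h1 (p₀ x)
  rw [h2] at h3
  linear_combination (norm := module) h3 - h4

theorem SplitRelations.adjoint_pos_neg (h : SplitRelations p m p₀ π ρ) (hρ : adjoint ρ = ρ)
    (x : E) : adjoint p (m x) - adjoint p₀ (m x) = adjoint p (p₀ x) - adjoint p₀ (p₀ x) := by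
  have h1 : m x - ρ (m x) = p₀ x - ρ (p₀ x) := congrArg (fun A => A x) h.comp_neg
  have h2 : ∀ y, adjoint p (ρ y) = adjoint p₀ (ρ y) := by
    intro y
    have := congrArg (fun A => adjoint A y) h.comp_pos
    simpa only [adjoint_comp, hρ, comp_apply] using this
  have h3 := congrArg (adjoint p) h1
  have h4 := congrArg (adjoint p₀) h1
  simp only [map_sub, h2] at h3 h4
  linear_combination (norm := module) h3 - h4

theorem SplitRelations.pos_adjoint_neg (h : SplitRelations p m p₀ π ρ) (hπ : adjoint π = π)
    (y : F) : p (adjoint m y) - p₀ (adjoint m y) = p (adjoint p₀ y) - p₀ (adjoint p₀ y) := by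
  have h1 : adjoint m y - π (adjoint m y) = adjoint p₀ y - π (adjoint p₀ y) := by
    have := congrArg (fun A => adjoint A y) h.neg_comp
    simpa only [map_sub, adjoint_comp, hπ, sub_apply, comp_apply] using this
  have h2 : ∀ x, p (π x) = p₀ (π x) := fun x => congrArg (fun A => A x) h.pos_comp
  have h3 := congrArg p h1
  have h4 := congrArg p₀ h1
  simp only [map_sub, h2] at h3 h4
  linear_combination (norm := module) h3 - h4

/-- The co-analytic part restricted to its initial space has constant `m π m*`. -/
theorem SplitRelations.neg_comp_adjoint (h : SplitRelations p m p₀ π ρ) (hπ : adjoint π = π)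
    (y : F) :
    m (π (adjoint m y)) = m (adjoint m y)
      - (p₀ (adjoint p₀ y) - p₀ (π (adjoint p₀ y))) := by
  have h1 : adjoint m y - π (adjoint m y) = adjoint p₀ y - π (adjoint p₀ y) := by
    have := congrArg (fun A => adjoint A y) h.neg_comp
    simpa only [map_sub, adjoint_comp, hπ, sub_apply, comp_apply] using this
  have h2 : ∀ x, m x - m (π x) = p₀ x - p₀ (π x) := fun x => congrArg (fun A => A x) h.neg_comp
  have h3 := h2 (adjoint m y)
  have h4 := congrArg p₀ h1
  simp only [map_sub] at h4
  linear_combination (norm := module) -h3 - h4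

/-- The partial isometry relation, restricted to the initial space of the co-analytic part. -/
theorem SplitRelations.partialIsometry_comp (h : SplitRelations p m p₀ π ρ)
    (hπ : adjoint π = π) (hρ : adjoint ρ = ρ) {φ : E →L[ℂ] F} (hφ : φ = p + m - p₀)
    (hpi : ∀ x, φ (adjoint φ (φ x)) = φ x) (h0 : p₀ ∘L π = ρ ∘L p₀ ∘L π) (x : E) :
    p (adjoint p₀ (m (π x))) - p₀ (adjoint p₀ (m (π x))) + m (adjoint m (m (π x)))
      = m (π x) := by
  have h1 : ρ (m (π x)) = m (π x) := by
    have h2 : m (π x) - ρ (m (π x)) = p₀ (π x) - ρ (p₀ (π x)) :=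
      congrArg (fun A => A (π x)) h.comp_neg
    have h3 : p₀ (π x) = ρ (p₀ (π x)) := congrArg (fun A => A x) h0
    rw [← h3, sub_self, sub_eq_zero] at h2
    exact h2.symm
  have h2 : adjoint p (m (π x)) = adjoint p₀ (m (π x)) := by
    have := congrArg (fun A => adjoint A (m (π x))) h.comp_pos
    simpa only [adjoint_comp, hρ, comp_apply, h1] using this
  have h3 : φ (π x) = m (π x) := by
    have h4 : p (π x) = p₀ (π x) := congrArg (fun A => A x) h.pos_comp
    rw [hφ, sub_apply, add_apply, h4]
    abel
  have h4 : adjoint φ (m (π x)) = adjoint m (m (π x)) := by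
    rw [hφ, map_sub, map_add, sub_apply, add_apply, h2]
    abel
  have h5 := hpi (π x)
  rw [h3, h4, hφ, sub_apply, add_apply] at h5
  rw [← h.pos_adjoint_neg hπ]
  linear_combination (norm := module) h5

end Split

end Converse

/-! ### Sufficiency of the two conditions. -/

section Main

open ContinuousLinearMap
open scoped InnerProductSpace

variable {E F G : Type*}
  [NormedAddCommGroup E] [InnerProductSpace ℂ E] [CompleteSpace E] [FiniteDimensional ℂ E]
  [NormedAddCommGroup F] [InnerProductSpace ℂ F] [CompleteSpace F] [FiniteDimensional ℂ F]
  [NormedAddCommGroup G] [InnerProductSpace ℂ G] [CompleteSpace G] [FiniteDimensional ℂ G]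

/-- The projection onto the final space of the co-analytic coefficients of positive order. -/
def finalProj (Φ : LInf E F) : F →L[ℂ] F :=
  rangeProj fun n : ℕ => symbolCoeff Φ (-((n + 1 : ℕ) : ℤ))

/-- The projection onto the initial space of the co-analytic coefficients of positive order. -/
def initialProj (Φ : LInf E F) : E →L[ℂ] E :=
  rangeProj fun n : ℕ => adjoint (symbolCoeff Φ (-((n + 1 : ℕ) : ℤ)))

/-- The coefficients of the analytic and the co-analytic part have orthogonal ranges and
orthogonal initial spaces. -/
def HasOrthogonalCoeffs (Φ : LInf E F) : Prop :=
  ∀ m n : ℕ, adjoint (symbolCoeff Φ ((m + 1 : ℕ) : ℤ)) ∘L symbolCoeff Φ (-((n + 1 : ℕ) : ℤ)) = 0 ∧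
    symbolCoeff Φ (-((n + 1 : ℕ) : ℤ)) ∘L adjoint (symbolCoeff Φ ((m + 1 : ℕ) : ℤ)) = 0

theorem adjoint_finalProj (Φ : LInf E F) : adjoint (finalProj Φ) = finalProj Φ :=
  adjoint_rangeProj _

theorem adjoint_initialProj (Φ : LInf E F) : adjoint (initialProj Φ) = initialProj Φ :=
  adjoint_rangeProj _

theorem finalProj_comp (Φ : LInf E F) (n : ℕ) :
    finalProj Φ ∘L symbolCoeff Φ (-((n + 1 : ℕ) : ℤ)) = symbolCoeff Φ (-((n + 1 : ℕ) : ℤ)) :=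
  rangeProj_comp _ n

theorem comp_initialProj (Φ : LInf E F) (n : ℕ) :
    symbolCoeff Φ (-((n + 1 : ℕ) : ℤ)) ∘L initialProj Φ = symbolCoeff Φ (-((n + 1 : ℕ) : ℤ)) := by
  have h := congrArg adjoint
    (rangeProj_comp (fun n : ℕ => adjoint (symbolCoeff Φ (-((n + 1 : ℕ) : ℤ)))) n)
  rw [adjoint_comp, adjoint_rangeProj, adjoint_adjoint] at h
  exact h

/-- In each relation the linear image of `P` or `M` has no Fourier coefficients of nonzero index, by
orthogonality or by the choice of the projections, hence equals its mean. -/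
theorem splitRelations {Φ P M : LInf E F} (h : IsBoundaryDecomposition Φ P M)
    (ho : HasOrthogonalCoeffs Φ) :
    ∀ᵐ t ∂(haarAddCircle : Measure Torus),
      SplitRelations (P t) (M t) (symbolCoeff Φ 0) (initialProj Φ) (finalProj Φ) := by
  let R : (E →L[ℂ] F) →L[ℂ] (E →L[ℂ] F) := (compL ℂ E E F).flip (initialProj Φ)
  let L : (E →L[ℂ] F) →L[ℂ] (E →L[ℂ] F) := compL ℂ E F F (finalProj Φ)
  have h1 := h.clm_pos R (fun m => comp_rangeProj_eq_zero _ fun n => by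
    have := adjoint_comp_eq_zero (ho m n).2
    rwa [adjoint_adjoint] at this)
  have h2 := h.clm_neg (ContinuousLinearMap.id ℂ _ - R) (fun m => by
    show _ - symbolCoeff Φ _ ∘L initialProj Φ = 0
    rw [comp_initialProj]
    exact sub_self _)
  have h3 := h.clm_neg (ContinuousLinearMap.id ℂ _ - L) (fun m => by
    show _ - finalProj Φ ∘L symbolCoeff Φ _ = 0
    rw [finalProj_comp]
    exact sub_self _)
  have h4 := h.clm_pos L (fun m => by
    have := adjoint_comp_eq_zero (comp_rangeProj_eq_zero
      (fun n : ℕ => symbolCoeff Φ (-((n + 1 : ℕ) : ℤ))) fun n => (ho m n).1)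
    rwa [adjoint_adjoint, adjoint_rangeProj] at this)
  filter_upwards [h1, h2, h3, h4] with t h1 h2 h3 h4
  exact ⟨h1, h2, h3, h4⟩

/-- `(1 - ρ) M` equals the constant `(1 - ρ) p₀`, so `M ((1 - ρ) p₀)* = (M M*) (1 - ρ)` is constant.
The coefficients `Φ̂(-n)`, `n ≥ 1`, thus vanish on the range of `((1 - ρ) p₀)*`, which says `(1 - ρ)
p₀ π = 0`. -/
theorem mean_comp_initialProj {Φ P M : LInf E F} (h : IsBoundaryDecomposition Φ P M)
    (ho : HasOrthogonalCoeffs Φ) {B : F →L[ℂ] F}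
    (hB : ∀ᵐ t ∂(haarAddCircle : Measure Torus), M t ∘L adjoint (M t) = B) :
    symbolCoeff Φ 0 ∘L initialProj Φ = finalProj Φ ∘L symbolCoeff Φ 0 ∘L initialProj Φ := by
  set p₀ := symbolCoeff Φ 0 with hp₀
  set ρ := finalProj Φ with hρ
  let Y : F →L[ℂ] E := adjoint (p₀ - ρ ∘L p₀)
  have h1 : ∀ᵐ t ∂(haarAddCircle : Measure Torus),
      ((compL ℂ F E F).flip Y) (M t) = adjoint (B - ρ ∘L B) := by
    filter_upwards [hB, splitRelations h ho] with t h1 h2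
    show M t ∘L Y = _
    rw [← h1, ← comp_assoc, ← sub_comp, h2.comp_neg, adjoint_comp, adjoint_adjoint]
  have h2 : ∀ n : ℕ, symbolCoeff Φ (-((n + 1 : ℕ) : ℤ)) ∘L Y = 0 := by
    intro n
    rw [← h.coeff_neg _ (by omega)]
    have h3 : ∀ x, symbolCoeff M (-((n + 1 : ℕ) : ℤ)) (Y x) = 0 := by
      intro x
      refine M.clm_symbolCoeff_eq_zero (ContinuousLinearMap.apply ℂ F (Y x))
        (v := adjoint (B - ρ ∘L B) x) ?_ (by omega)
      filter_upwards [h1] with t ht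
      exact congrArg (fun A => A x) ht
    exact ContinuousLinearMap.ext h3
  have h3 : adjoint Y ∘L initialProj Φ = 0 :=
    comp_rangeProj_eq_zero _ fun n => adjoint_comp_eq_zero (h2 n)
  rw [adjoint_adjoint, sub_comp, sub_eq_zero] at h3
  exact h3

/-- The key relation `Φ̂(m) Φ̂(0)* Φ̂(-n) = 0` for `m, n ≥ 1`. -/
theorem coeff_comp_mean_comp_coeff {Φ P M : LInf E F} (h : IsBoundaryDecomposition Φ P M)
    (ho : HasOrthogonalCoeffs Φ) {B : F →L[ℂ] F}
    (hB : ∀ᵐ t ∂(haarAddCircle : Measure Torus), M t ∘L adjoint (M t) = B)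
    (hpi : ∀ᵐ t ∂(haarAddCircle : Measure Torus), IsPartialIsometry (Φ t)) (m n : ℕ) :
    symbolCoeff Φ ((m + 1 : ℕ) : ℤ) ∘L adjoint (symbolCoeff Φ 0) ∘L
      symbolCoeff Φ (-((n + 1 : ℕ) : ℤ)) = 0 := by
  set p₀ := symbolCoeff Φ 0 with hp₀
  set π := initialProj Φ with hπ
  set a := symbolCoeff Φ ((m + 1 : ℕ) : ℤ) with ha
  let D : F →L[ℂ] F := B - (p₀ ∘L adjoint p₀ - p₀ ∘L π ∘L adjoint p₀)
  have hD : ∀ᵐ t ∂(haarAddCircle : Measure Torus), ∀ y, M t (π (adjoint (M t) y)) = D y := by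
    filter_upwards [hB, splitRelations h ho] with t h1 h2 y
    rw [h2.neg_comp_adjoint (adjoint_initialProj Φ), ← comp_apply, h1]
    rfl
  -- The partial isometry relation evaluated at `π M* y` expresses `P p₀* D y` through constants
  -- only, so its positive coefficients vanish.
  have h1 : ∀ y, a (adjoint p₀ (D y)) = 0 := by
    intro y
    have h0 := mean_comp_initialProj h ho hB
    refine h.clm_coeff_pos (ContinuousLinearMap.apply ℂ F (adjoint p₀ (D y)))
      (v := D y - B (D y) + p₀ (adjoint p₀ (D y))) ?_ m
    filter_upwards [hB, hD, splitRelations h ho, hpi, h.sum] with t h1 h2 h3 h4 h5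
    have h6 := h3.partialIsometry_comp (adjoint_initialProj Φ) (adjoint_finalProj Φ) h5
      (isPartialIsometry_iff.1 h4) h0 (adjoint (M t) y)
    rw [← hπ, h2, ← comp_apply (M t), h1] at h6
    show P t _ = _
    linear_combination (norm := module) h6
  -- Since `D = (M π) (M π)*`, the relation `a p₀* D = 0` gives `(a p₀* M π) (a p₀* M π)* = 0`,
  -- hence `a p₀* M π = 0`.
  have h2 : ∀ᵐ t ∂(haarAddCircle : Measure Torus), ∀ x, a (adjoint p₀ (M t (π x))) = 0 := by
    filter_upwards [hD] with t ht
    have hs : ∀ x y : E, ⟪π x, y⟫_ℂ = ⟪x, π y⟫_ℂ := fun x y => by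
      rw [← adjoint_inner_right, hπ, adjoint_initialProj]
    have h3 : ∀ w, π (adjoint (M t) (p₀ (adjoint a w))) = 0 := by
      intro w
      have hππ : ∀ x, π (π x) = π x := rangeProj_rangeProj _
      rw [← inner_self_eq_zero (𝕜 := ℂ), hs, hππ, adjoint_inner_left, ht,
        ← adjoint_inner_right p₀, adjoint_inner_left, h1, inner_zero_right]
    intro x
    refine ext_inner_left ℂ fun w => ?_
    rw [inner_zero_right, ← adjoint_inner_left, adjoint_inner_right, ← adjoint_inner_left, ← hs,
      h3, inner_zero_left]
  ext1 x
  have h3 := h.clm_coeff_neg (a ∘L adjoint p₀ ∘L ContinuousLinearMap.apply ℂ F (π x)) (v := 0) (by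
    filter_upwards [h2] with t ht
    exact ht x) n
  have h4 : symbolCoeff Φ (-((n + 1 : ℕ) : ℤ)) (π x) = symbolCoeff Φ (-((n + 1 : ℕ) : ℤ)) x :=
    congrArg (fun A => A x) (comp_initialProj Φ n)
  rw [comp_apply, comp_apply, ← h4]
  exact h3

/-- The key relation, summed over the ranges of the `Φ̂(-n)`: all positive coefficients of `P p₀* ρ`
vanish, leaving its mean. -/
theorem ae_pos_comp_finalProj {Φ P M : LInf E F} (h : IsBoundaryDecomposition Φ P M)
    (hk : ∀ m n : ℕ, symbolCoeff Φ ((m + 1 : ℕ) : ℤ) ∘L adjoint (symbolCoeff Φ 0) ∘L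
      symbolCoeff Φ (-((n + 1 : ℕ) : ℤ)) = 0) :
    ∀ᵐ t ∂(haarAddCircle : Measure Torus), ∀ y,
      P t (adjoint (symbolCoeff Φ 0) (finalProj Φ y))
        = symbolCoeff Φ 0 (adjoint (symbolCoeff Φ 0) (finalProj Φ y)) := by
  have h1 := h.clm_pos ((compL ℂ F E F).flip (adjoint (symbolCoeff Φ 0) ∘L finalProj Φ))
    (fun m => comp_rangeProj_eq_zero _ (X := symbolCoeff Φ _ ∘L adjoint (symbolCoeff Φ 0))
      fun n => hk m n)
  filter_upwards [h1] with t ht y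
  exact congrArg (fun A => A y) ht

theorem laurent_mem_H2 {Φ : LInf E F} (h : ∀ n : ℤ, n < 0 → symbolCoeff Φ n = 0) {f : L2 E}
    (hf : f ∈ H2 E) : laurent Φ f ∈ H2 F := by
  intro k hk
  refine ext_inner_left ℂ fun e => ?_
  rw [inner_zero_right, ← inner_modulate_constL2, ← adjoint_inner_left, adjoint_laurent,
    laurent_modulate]
  apply L2.inner_eq_zero_of_fourierCoeff
  intro n
  rcases lt_or_ge n 0 with hn | hn
  · exact Or.inr (hf n hn)
  · left
    rw [fourierCoeff_modulate, fourierCoeff_laurent_constL2, symbolCoeff_adjSymbol,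
      h _ (by omega), map_zero, zero_apply]

theorem adjoint_mem_orthogonal_H2 {A : L2 E →L[ℂ] L2 F} (hA : ∀ f ∈ H2 E, A f ∈ H2 F) {g : L2 F}
    (hg : g ∈ (H2 F)ᗮ) : adjoint A g ∈ (H2 E)ᗮ := by
  intro f hf
  rw [adjoint_inner_right]
  exact hg _ (hA f hf)

theorem constSymbol_mem_H2 (A : E →L[ℂ] F) {f : L2 E} (hf : f ∈ H2 E) :
    laurent (constSymbol A) f ∈ H2 F :=
  laurent_mem_H2 (fun n hn => by rw [symbolCoeff_constSymbol, if_neg hn.ne]) hf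

theorem adjSymbol_constSymbol (A : E →L[ℂ] F) :
    adjSymbol (constSymbol A) = constSymbol (adjoint A) := by
  apply Lp.ext
  filter_upwards [coeFn_adjSymbol (constSymbol A), coeFn_constSymbol A,
    coeFn_constSymbol (adjoint A)] with t h1 h2 h3
  rw [h1, h2, h3]

theorem constSymbol_mem_orthogonal_H2 (A : E →L[ℂ] F) {f : L2 E} (hf : f ∈ (H2 E)ᗮ) :
    laurent (constSymbol A) f ∈ (H2 F)ᗮ := by
  have h := adjoint_mem_orthogonal_H2
    (fun f hf => constSymbol_mem_H2 (adjoint A) (f := f) hf) hf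
  rwa [adjoint_laurent, adjSymbol_constSymbol, adjoint_adjoint] at h

theorem coeFn_laurent_constSymbol (A : E →L[ℂ] F) (f : L2 E) :
    ∀ᵐ t ∂(haarAddCircle : Measure Torus), laurent (constSymbol A) f t = A (f t) := by
  filter_upwards [laurent_coeFn (constSymbol A) f, coeFn_constSymbol A] with t h1 h2
  rw [h1, h2]

theorem starProjection_H2_eq {f g : L2 E} (hg : g ∈ H2 E) (h : f - g ∈ (H2 E)ᗮ) :
    (H2 E).starProjection f = g :=
  Submodule.eq_starProjection_of_mem_orthogonal hg h

theorem isPartialIsometry_of_conditions {Φ P M : LInf E F} (h : IsBoundaryDecomposition Φ P M)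
    (ho : HasOrthogonalCoeffs Φ) {A : E →L[ℂ] E} {B : F →L[ℂ] F}
    (hA : ∀ᵐ t ∂(haarAddCircle : Measure Torus), adjoint (P t) ∘L P t = A)
    (hB : ∀ᵐ t ∂(haarAddCircle : Measure Torus), M t ∘L adjoint (M t) = B)
    (hpi : ∀ᵐ t ∂(haarAddCircle : Measure Torus), IsPartialIsometry (Φ t)) :
    IsPartialIsometry (toeplitz Φ) := by
  rw [isPartialIsometry_iff]
  rintro ⟨f, hf⟩
  apply Subtype.ext
  rw [adjoint_toeplitz]
  simp only [coe_toeplitz]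
  set p₀ := symbolCoeff Φ 0 with hp₀
  set ρ := finalProj Φ with hρ
  have hsplit := splitRelations h ho
  have hkey := ae_pos_comp_finalProj h
    (coeff_comp_mean_comp_coeff h ho hB hpi)
  set v := (H2 F).starProjection (laurent M f) with hv
  set w := laurent M f - v with hw
  have hvH : v ∈ H2 F := Submodule.starProjection_apply_mem _ _
  have hwH : w ∈ (H2 F)ᗮ :=
    (H2 F).sub_starProjection_mem_orthogonal (laurent M f)
  have hPH : ∀ g ∈ H2 E, laurent P g ∈ H2 F := fun g hg => laurent_mem_H2 h.coeff_pos_neg hg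
  have hMH : ∀ g ∈ H2 F, laurent (adjSymbol M) g ∈ H2 E := fun g hg =>
    laurent_mem_H2 (fun n hn => by
      rw [symbolCoeff_adjSymbol, h.coeff_neg_pos _ (by omega), map_zero]) hg
  have hΦf : ∀ᵐ t ∂(haarAddCircle : Measure Torus),
      laurent Φ f t = P t (f t) + M t (f t) - p₀ (f t) := by
    filter_upwards [laurent_coeFn Φ f, h.sum] with t h1 h2
    rw [h1, h2]
    rfl
  have hwt : ∀ᵐ t ∂(haarAddCircle : Measure Torus), w t = M t (f t) - v t := by
    filter_upwards [Lp.coeFn_sub (laurent M f) v, laurent_coeFn M f] with t h1 h2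
    rw [hw, h1, Pi.sub_apply, h2]
  -- the first application of the Toeplitz operator
  let u : L2 F := laurent P f + v - laurent (constSymbol p₀) f
  have hu : (H2 F).starProjection (laurent Φ f) = u := by
    apply starProjection_H2_eq
    · exact Submodule.sub_mem _ (Submodule.add_mem _ (hPH f hf) hvH) (constSymbol_mem_H2 _ hf)
    · convert! hwH using 1
      apply Lp.ext
      filter_upwards [hΦf, hwt, Lp.coeFn_sub (laurent Φ f) u,
        Lp.coeFn_sub (laurent P f + v) (laurent (constSymbol p₀) f),
        Lp.coeFn_add (laurent P f) v, laurent_coeFn P f, coeFn_laurent_constSymbol p₀ f]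
        with t h1 h2 h3 h4 h5 h6 h7
      rw [h3, Pi.sub_apply, h1, h4, Pi.sub_apply, h5, Pi.add_apply, h6, h7, h2]
      abel
  have hut : ∀ᵐ t ∂(haarAddCircle : Measure Torus), u t = P t (f t) + v t - p₀ (f t) := by
    filter_upwards [Lp.coeFn_sub (laurent P f + v) (laurent (constSymbol p₀) f),
        Lp.coeFn_add (laurent P f) v, laurent_coeFn P f, coeFn_laurent_constSymbol p₀ f]
        with t h4 h5 h6 h7
    rw [h4, Pi.sub_apply, h5, Pi.add_apply, h6, h7]
  -- the application of its adjoint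
  let q : L2 E := laurent (constSymbol (A - adjoint p₀ ∘L p₀)) f + laurent (adjSymbol M) v
  have hqt : ∀ᵐ t ∂(haarAddCircle : Measure Torus),
      q t = A (f t) - adjoint p₀ (p₀ (f t)) + adjoint (M t) (v t) := by
    filter_upwards [Lp.coeFn_add (laurent (constSymbol (A - adjoint p₀ ∘L p₀)) f)
      (laurent (adjSymbol M) v), coeFn_laurent_constSymbol (A - adjoint p₀ ∘L p₀) f,
      laurent_coeFn (adjSymbol M) v, coeFn_adjSymbol M] with t h1 h2 h3 h4
    rw [h1, Pi.add_apply, h2, h3, h4]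
    rfl
  have hq : (H2 E).starProjection (laurent (adjSymbol Φ) u) = q := by
    apply starProjection_H2_eq
    · exact Submodule.add_mem _ (constSymbol_mem_H2 _ hf) (hMH v hvH)
    · have h1 : laurent (adjSymbol Φ) u - q
          = laurent (constSymbol (adjoint p₀)) w - laurent (adjSymbol P) w := by
        apply Lp.ext
        filter_upwards [Lp.coeFn_sub (laurent (adjSymbol Φ) u) q,
          Lp.coeFn_sub (laurent (constSymbol (adjoint p₀)) w) (laurent (adjSymbol P) w),
          coeFn_laurent_constSymbol (adjoint p₀) w, laurent_coeFn (adjSymbol P) w,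
          coeFn_adjSymbol P, laurent_coeFn (adjSymbol Φ) u, coeFn_adjSymbol Φ, hqt, hut, hwt,
          h.sum, hsplit, hA] with t h1 h2 h3 h4 h5 h6 h7 h8 h9 h10 h11 h12 h13
        have h14 := h12.adjoint_neg_pos (adjoint_finalProj Φ) (f t)
        have h15 := h12.adjoint_pos_neg (adjoint_finalProj Φ) (f t)
        have h16 : adjoint (P t) (P t (f t)) = A (f t) := congrArg (fun A => A (f t)) h13
        rw [h1, h2, Pi.sub_apply, Pi.sub_apply, h3, h4, h5, h6, h7, h8, h9, h10, h11]
        simp only [map_sub, map_add, sub_apply, add_apply]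
        linear_combination (norm := module) h14 + h15 + h16
      rw [h1]
      refine Submodule.sub_mem _ (constSymbol_mem_orthogonal_H2 _ hwH) ?_
      rw [← adjoint_laurent]
      exact adjoint_mem_orthogonal_H2 hPH hwH
  -- Since `(1 - ρ) M = (1 - ρ) p₀`, the function `(1 - ρ) w` belongs to `H²` as well as to its
  -- orthogonal complement. This brings `w` within reach of the key relation.
  have hw' : laurent (constSymbol ρ) w = w := by
    rw [eq_comm, ← sub_eq_zero]
    have h1 : w - laurent (constSymbol ρ) w ∈ (H2 F)ᗮ :=
      Submodule.sub_mem _ hwH (constSymbol_mem_orthogonal_H2 _ hwH)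
    have h2 : w - laurent (constSymbol ρ) w
        = laurent (constSymbol (p₀ - ρ ∘L p₀)) f - (v - laurent (constSymbol ρ) v) := by
      apply Lp.ext
      filter_upwards [Lp.coeFn_sub w (laurent (constSymbol ρ) w),
        Lp.coeFn_sub (laurent (constSymbol (p₀ - ρ ∘L p₀)) f) (v - laurent (constSymbol ρ) v),
        Lp.coeFn_sub v (laurent (constSymbol ρ) v), coeFn_laurent_constSymbol ρ w,
        coeFn_laurent_constSymbol ρ v, coeFn_laurent_constSymbol (p₀ - ρ ∘L p₀) f, hwt, hsplit]
        with t h1 h2 h3 h4 h5 h6 h7 h8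
      have h9 : M t (f t) - ρ (M t (f t)) = p₀ (f t) - ρ (p₀ (f t)) :=
        congrArg (fun A => A (f t)) h8.comp_neg
      rw [h1, h2, Pi.sub_apply, Pi.sub_apply, h3, Pi.sub_apply, h4, h5, h6, h7]
      simp only [map_sub, sub_apply, comp_apply]
      linear_combination (norm := module) h9
    have h3 : w - laurent (constSymbol ρ) w ∈ H2 F := by
      rw [h2]
      exact Submodule.sub_mem _ (constSymbol_mem_H2 _ hf)
        (Submodule.sub_mem _ hvH (constSymbol_mem_H2 _ hvH))
    exact inner_self_eq_zero (𝕜 := ℂ) |>.1 (h1 _ h3)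
  -- the second application of the Toeplitz operator
  have hfin : laurent Φ f - laurent Φ q = laurent (constSymbol B) w := by
    apply Lp.ext
    filter_upwards [Lp.coeFn_sub (laurent Φ f) (laurent Φ q), laurent_coeFn Φ f,
      laurent_coeFn Φ q, coeFn_laurent_constSymbol B w, hqt, hwt, h.sum, hsplit, hA, hB, hpi,
      hkey, coeFn_laurent_constSymbol ρ w] with t h1 h2 h3 h4 h5 h6 h7 h8 h9 h10 h11 h12 h13
    have h14 := h8.adjoint_neg_pos (adjoint_finalProj Φ) (f t)
    have h15 := h8.adjoint_pos_neg (adjoint_finalProj Φ) (f t)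
    have h16 : adjoint (P t) (P t (f t)) = A (f t) := congrArg (fun A => A (f t)) h9
    have h17 := isPartialIsometry_iff.1 h11 (f t)
    have h18 : adjoint (Φ t) (Φ t (f t))
        = A (f t) - adjoint p₀ (p₀ (f t)) + adjoint (M t) (M t (f t)) := by
      rw [h7]
      simp only [map_sub, map_add, sub_apply, add_apply]
      linear_combination (norm := module) h14 + h15 + h16
    -- `(P - p₀) M* w = (P - p₀) p₀* w`, and this vanishes by the key relation because `w = ρ w`;
    -- only `M M* w` survives.
    have h19 : Φ t (adjoint (M t) (w t)) = B (w t) := by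
      have h20 := h8.pos_adjoint_neg (adjoint_initialProj Φ) (w t)
      have h21 : M t (adjoint (M t) (w t)) = B (w t) := congrArg (fun A => A (w t)) h10
      have h22 := h12 (w t)
      rw [hw'] at h13
      rw [← hρ, ← h13] at h22
      rw [h7]
      simp only [sub_apply, add_apply]
      linear_combination (norm := module) h20 + h21 + h22
    rw [h1, Pi.sub_apply, h2, h3, h4, ← h19, ← h17, h18, h5, h6, ← map_sub]
    congr 1
    rw [map_sub]
    abel
  rw [hu, hq]
  have h1 : (H2 F).starProjection (laurent Φ f - laurent Φ q) = 0 := by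
    rw [hfin]
    apply starProjection_H2_eq (Submodule.zero_mem _)
    rw [sub_zero]
    exact constSymbol_mem_orthogonal_H2 _ hwH
  rw [map_sub, hu, sub_eq_zero] at h1
  exact h1.symm

end Main

end ToeplitzPI

end

theorem mainTheorem2 {E F : Type*}
    [NormedAddCommGroup E] [InnerProductSpace ℂ E] [CompleteSpace E] [FiniteDimensional ℂ E]
    [NormedAddCommGroup F] [InnerProductSpace ℂ F] [CompleteSpace F] [FiniteDimensional ℂ F]
    (Φ : ToeplitzPI.LInf E F) (hA : Φ ∈ ToeplitzPI.HInfAddHInfBar E F) (hne : Φ ≠ 0)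
    (hpi : ∀ᵐ t ∂(haarAddCircle : Measure ToeplitzPI.Torus),
      ToeplitzPI.IsPartialIsometry ((Φ : ToeplitzPI.Torus → E →L[ℂ] F) t)) :
    ToeplitzPI.IsPartialIsometry (ToeplitzPI.toeplitz Φ) ↔
      ((ToeplitzPI.IsContractiveAnalytic (ToeplitzPI.analyticPart Φ) ∧
          ∃ f : ToeplitzPI.Torus → E →L[ℂ] F,
            ToeplitzPI.HasBoundaryValues (ToeplitzPI.analyticPart Φ) f ∧
            ToeplitzPI.IsAEConstant (fun t => ContinuousLinearMap.adjoint (f t) ∘L f t)) ∧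
        (ToeplitzPI.IsContractiveAnalytic
            (fun z => ContinuousLinearMap.adjoint (ToeplitzPI.coanalyticPart Φ z)) ∧
          ∃ g : ToeplitzPI.Torus → E →L[ℂ] F,
            ToeplitzPI.HasBoundaryValues (ToeplitzPI.coanalyticPart Φ) g ∧
            ToeplitzPI.IsAEConstant (fun t => g t ∘L ContinuousLinearMap.adjoint (g t)))) ∧
      (∀ m n : ℕ, 1 ≤ m → 1 ≤ n →
        ContinuousLinearMap.adjoint (ToeplitzPI.symbolCoeff Φ (m : ℤ)) ∘L
            ToeplitzPI.symbolCoeff Φ (-(n : ℤ)) = 0 ∧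
        ToeplitzPI.symbolCoeff Φ (-(n : ℤ)) ∘L
            ContinuousLinearMap.adjoint (ToeplitzPI.symbolCoeff Φ (m : ℤ)) = 0) := by
  refine ⟨ToeplitzPI.conditions_of_isPartialIsometry hA, ?_⟩
  rintro ⟨⟨⟨-, f, hf, A, hfA⟩, -, g, hg, B, hgB⟩, ho⟩
  -- Radial limits are unique, so the constancy assumed for `f` and `g` transfers to `P` and `M`.
  obtain ⟨P, M, h⟩ := ToeplitzPI.exists_boundaryDecomposition hA
  refine ToeplitzPI.isPartialIsometry_of_conditions (A := A) (B := B) h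
    (fun m n => ho (m + 1) (n + 1) (by omega) (by omega)) ?_ ?_ hpi
  · filter_upwards [hfA, hf.unique h.boundary_pos] with t h1 h2
    rw [← h2]
    exact h1
  · filter_upwards [hgB, hg.unique h.boundary_neg] with t h1 h2
    rw [← h2]
    exact h1
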